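/- Let $L,\tau,a,\kappa_1,c_0>0$, $\kappa_2\in\mathbb R\setminus\{0\}$ and $0<\alpha<\beta<\gamma<L$. Let $b=1$ on $(0,\beta)$ and $b=0$ on $(\beta,L)$, and let $c=c_0$ on $(\alpha,\gamma)$ and $c=0$ on $(0,\alpha)\cup(\gamma,L)$. Put $H^1_L(0,\beta)=\{\eta\in H^1(0,\beta):\eta(0)=0\}$, with the inner product $\int_0^\beta\eta_x\overline{\zeta_x}\,dx$, and $\mathcal W=L^2((0,1);H^1_L(0,\beta))$. Let $\mathcal H=(H^1_0(0,L)\times L^2(0,L))^2\times\mathcal W$ be the complex Hilbert space of states $U=(u,v,y,z,\eta)$ with the inner product $$(U,U^1)_{\mathcal H}=\int_0^L\bigl(a u_x\overline{u^1_x}+v\overline{v^1}+y_x\overline{y^1_x}+z\overline{z^1}\bigr)dx+\tau|\kappa_2|\int_0^\beta\!\int_0^1\eta_x\overline{\eta^1_x}\,d\rho\,dx .$$ Put $S_b(u,v,\eta)=a u_x+b(\kappa_1 v_x+\kappa_2\eta_x(\cdot,1))$. Let $\mathcal A$ be the operator $$\mathcal A(u,v,y,z,\eta)=\bigl(v,\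 (S_b(u,v,\eta))_x-cz,\ z,\ y_{xx}+cv,\ -\tau^{-1}\eta_\rho\bigr)$$ whose domain $D(\mathcal A)$ consists of all $(u,v,y,z,\eta)\in\mathcal H$ with $y\in H^2(0,L)\cap H^1_0(0,L)$, $v,z\in H^1_0(0,L)$, $(S_b(u,v,\eta))_x\in L^2(0,L)$, $\eta_\rho\in\mathcal W$ and $\eta(\cdot,0)=v$ on $(0,\beta)$. Assume (H): $\kappa_1>0$, $\kappa_2\in\mathbb R\setminus\{0\}$ and $|\kappa_2|<\kappa_1$. Then: 1. $\mathcal A$ is m-dissipative in $\mathcal H$, that is, $\Re(\mathcal AU,U)_{\mathcal H}\le0$ for all $U\in D(\mathcal A)$, and $\mu I-\mathcal A:D(\mathcal A)\to\mathcal H$ is surjective for every $\mu>0$. Moreover $D(\mathcal A)$ is dense in $\mathcal H$ and $0\in\rho(\mathcal A)$. 2. $\mathcal A$ is the infinitesimal generator of a $C_0$-semigroup of contractions $(e^{t\mathcal A})_{t\ge0}$ on $\mathcal H$. 3. For every $U_0\in\mathcal H$ the problem $U_t=\mathcal AU$, $U(0)=U_0$, has a unique weak solution $U\in C^0(\mathbb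 R^+,\mathcal H)$, and $U(t)=e^{t\mathcal A}U_0$. Here $U\in C^0(\mathbb R^+,\mathcal H)$ is a weak solution if $U(0)=U_0$ and, for every $V\in D(\mathcal A^*)$, the function $t\mapsto(U(t),V)_{\mathcal H}$ is differentiable on $[0,\infty)$ with derivative $(U(t),\mathcal A^*V)_{\mathcal H}$. 4. If $U_0\in D(\mathcal A)$, the same problem has a unique strong solution $U\in C^0(\mathbb R^+,D(\mathcal A))\cap C^1(\mathbb R^+,\mathcal H)$, where $D(\mathcal A)$ carries the graph norm, and $U(t)=e^{t\mathcal A}U_0$. -/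

import Mathlib

open MeasureTheory Set Filter Topology
open scoped ContDiff NNReal ENNReal

noncomputable section

set_option linter.unusedSectionVars false

namespace KelvinVoigt

/-- Lebesgue measure on the open interval `(0, ℓ)`. -/
abbrev vol (ℓ : ℝ) : Measure ℝ := volume.restrict (Ioo 0 ℓ)

/-- The Lebesgue–Bochner space `L²((0, ℓ); E)`. -/
abbrev L2 (ℓ : ℝ) (E : Type*) [NormedAddCommGroup E] := Lp E 2 (vol ℓ)

/-- Real test functions: smooth, with compact support contained in `(0, ℓ)`. -/
def IsTest (ℓ : ℝ) (φ : ℝ → ℝ) : Prop :=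
  ContDiff ℝ ∞ φ ∧ HasCompactSupport φ ∧ tsupport φ ⊆ Ioo 0 ℓ

section Weak

variable {E : Type*} [NormedAddCommGroup E] [NormedSpace ℂ E]

/-- `w` is the weak derivative of `u` on `(0, ℓ)`. -/
def HasWeakDeriv (ℓ : ℝ) (u w : L2 ℓ E) : Prop :=
  ∀ φ : ℝ → ℝ, IsTest ℓ φ →
    ∫ x, deriv φ x • u x ∂(vol ℓ) = - ∫ x, φ x • w x ∂(vol ℓ)

/-- Membership in `H¹((0, ℓ); E)`, for `u ∈ L²((0, ℓ); E)`. -/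
def IsH1 (ℓ : ℝ) (u : L2 ℓ E) : Prop := ∃ w : L2 ℓ E, HasWeakDeriv ℓ u w

/-- The continuous representative of `u` on `[0, ℓ]` takes the value `e` at `x`. -/
def HasTrace (ℓ : ℝ) (u : L2 ℓ E) (x : ℝ) (e : E) : Prop :=
  ∃ g : ℝ → E, ContinuousOn g (Icc 0 ℓ) ∧ u =ᵐ[vol ℓ] g ∧ g x = e

open Classical in
/-- The weak derivative of `u` (and `0` if there is none). -/
def wderiv (ℓ : ℝ) (u : L2 ℓ E) : L2 ℓ E :=
  if h : IsH1 ℓ u then h.choose else 0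

open Classical in
/-- The value at `x` of the continuous representative of `u` (and `0` if there is none). -/
def trace (ℓ : ℝ) (u : L2 ℓ E) (x : ℝ) : E :=
  if h : ∃ e, HasTrace ℓ u x e then h.choose else 0

/-! Basic facts on weak derivatives and traces. -/

theorem IsTest.deriv_cont {ℓ : ℝ} {φ : ℝ → ℝ} (h : IsTest ℓ φ) :
    Continuous (deriv φ) ∧ HasCompactSupport (deriv φ) :=
  ⟨h.1.continuous_deriv (by simp), h.2.1.deriv⟩

theorem integrable_L2 {ℓ : ℝ} (u : L2 ℓ E) : Integrable u (vol ℓ) :=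
  (Lp.memLp u).integrable (by norm_num)

theorem integrable_smul_L2 {ℓ : ℝ} (u : L2 ℓ E) {φ : ℝ → ℝ} (hφ : Continuous φ)
    (hs : HasCompactSupport φ) : Integrable (fun x => φ x • u x) (vol ℓ) := by
  obtain ⟨C, hC⟩ := hφ.bounded_above_of_compact_support hs
  exact (integrable_L2 u).bdd_smul (𝕜 := ℝ) C hφ.aestronglyMeasurable (Eventually.of_forall hC)

theorem HasWeakDeriv.add {ℓ : ℝ} {u w u' w' : L2 ℓ E} (h : HasWeakDeriv ℓ u w)
    (h' : HasWeakDeriv ℓ u' w') : HasWeakDeriv ℓ (u + u') (w + w') := by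
  intro φ hφ
  have e1 : ∫ x, deriv φ x • (u + u' : L2 ℓ E) x ∂(vol ℓ)
      = ∫ x, (deriv φ x • u x + deriv φ x • u' x) ∂(vol ℓ) := by
    apply integral_congr_ae
    filter_upwards [Lp.coeFn_add u u'] with x hx
    rw [hx, Pi.add_apply, smul_add]
  have e2 : ∫ x, φ x • (w + w' : L2 ℓ E) x ∂(vol ℓ)
      = ∫ x, (φ x • w x + φ x • w' x) ∂(vol ℓ) := by
    apply integral_congr_ae
    filter_upwards [Lp.coeFn_add w w'] with x hx
    rw [hx, Pi.add_apply, smul_add]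
  rw [e1, e2, integral_add (integrable_smul_L2 u hφ.deriv_cont.1 hφ.deriv_cont.2)
    (integrable_smul_L2 u' hφ.deriv_cont.1 hφ.deriv_cont.2),
    integral_add (integrable_smul_L2 w hφ.1.continuous hφ.2.1)
    (integrable_smul_L2 w' hφ.1.continuous hφ.2.1), h φ hφ, h' φ hφ, neg_add]

theorem HasWeakDeriv.smul {ℓ : ℝ} {u w : L2 ℓ E} (c : ℂ) (h : HasWeakDeriv ℓ u w) :
    HasWeakDeriv ℓ (c • u) (c • w) := by
  intro φ hφ
  have e1 : ∫ x, deriv φ x • (c • u : L2 ℓ E) x ∂(vol ℓ)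
      = ∫ x, c • (deriv φ x • u x) ∂(vol ℓ) := by
    apply integral_congr_ae
    filter_upwards [Lp.coeFn_smul c u] with x hx
    rw [hx, Pi.smul_apply, smul_comm]
  have e2 : ∫ x, φ x • (c • w : L2 ℓ E) x ∂(vol ℓ)
      = ∫ x, c • (φ x • w x) ∂(vol ℓ) := by
    apply integral_congr_ae
    filter_upwards [Lp.coeFn_smul c w] with x hx
    rw [hx, Pi.smul_apply, smul_comm]
  rw [e1, e2, integral_smul, integral_smul, h φ hφ, smul_neg]

theorem HasWeakDeriv.zero (ℓ : ℝ) : HasWeakDeriv ℓ (0 : L2 ℓ E) 0 := by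
  intro φ hφ
  have e : ∀ ψ : ℝ → ℝ, ∫ x, ψ x • (0 : L2 ℓ E) x ∂(vol ℓ) = 0 := by
    intro ψ
    apply integral_eq_zero_of_ae
    filter_upwards [Lp.coeFn_zero E 2 (vol ℓ)] with x hx
    rw [hx, Pi.zero_apply, smul_zero]
  rw [e, e, neg_zero]

theorem HasTrace.add {ℓ x : ℝ} {u u' : L2 ℓ E} {e e' : E} (h : HasTrace ℓ u x e)
    (h' : HasTrace ℓ u' x e') : HasTrace ℓ (u + u') x (e + e') := by
  obtain ⟨g, hg, hu, rfl⟩ := h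
  obtain ⟨g', hg', hu', rfl⟩ := h'
  refine ⟨g + g', hg.add hg', ?_, rfl⟩
  filter_upwards [Lp.coeFn_add u u', hu, hu'] with y h1 h2 h3
  rw [h1, Pi.add_apply, Pi.add_apply, h2, h3]

theorem HasTrace.smul {ℓ x : ℝ} {u : L2 ℓ E} {e : E} (c : ℂ) (h : HasTrace ℓ u x e) :
    HasTrace ℓ (c • u) x (c • e) := by
  obtain ⟨g, hg, hu, rfl⟩ := h
  refine ⟨c • g, hg.const_smul c, ?_, rfl⟩
  filter_upwards [Lp.coeFn_smul c u, hu] with y h1 h2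
  rw [h1, Pi.smul_apply, Pi.smul_apply, h2]

theorem HasTrace.zero (ℓ x : ℝ) : HasTrace ℓ (0 : L2 ℓ E) x 0 :=
  ⟨0, continuousOn_const, Lp.coeFn_zero E 2 (vol ℓ), rfl⟩

theorem HasTrace.unique {ℓ x : ℝ} (hx : x ∈ Icc 0 ℓ) (hℓ : 0 < ℓ) {u : L2 ℓ E} {e e' : E}
    (h : HasTrace ℓ u x e) (h' : HasTrace ℓ u x e') : e = e' := by
  obtain ⟨g, hg, hu, rfl⟩ := h
  obtain ⟨g', hg', hu', rfl⟩ := h'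
  have h0 : g =ᵐ[volume.restrict (Icc 0 ℓ)] g' := by
    rw [← restrict_Ioo_eq_restrict_Icc]
    exact hu.symm.trans hu'
  exact Measure.eqOn_Icc_of_ae_eq volume hℓ.ne h0 hg hg' hx

theorem HasTrace.trace_eq {ℓ x : ℝ} (hx : x ∈ Icc 0 ℓ) (hℓ : 0 < ℓ) {u : L2 ℓ E} {e : E}
    (h : HasTrace ℓ u x e) : trace ℓ u x = e := by
  have h' : ∃ e, HasTrace ℓ u x e := ⟨e, h⟩
  rw [trace, dif_pos h']
  exact h'.choose_spec.unique hx hℓ h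

theorem HasWeakDeriv.isH1 {ℓ : ℝ} {u w : L2 ℓ E} (h : HasWeakDeriv ℓ u w) : IsH1 ℓ u := ⟨w, h⟩

theorem IsH1.hasWeakDeriv {ℓ : ℝ} {u : L2 ℓ E} (h : IsH1 ℓ u) :
    HasWeakDeriv ℓ u (wderiv ℓ u) := by
  rw [wderiv, dif_pos h]
  exact h.choose_spec

variable [CompleteSpace E]

theorem HasWeakDeriv.unique {ℓ : ℝ} {u w w' : L2 ℓ E} (h : HasWeakDeriv ℓ u w)
    (h' : HasWeakDeriv ℓ u w') : w = w' := by
  have h0 := (h.add (h'.smul (-1)))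
  have key : ∀ᵐ x ∂(volume : Measure ℝ), x ∈ Ioo 0 ℓ → (w x - w' x) = 0 := by
    apply isOpen_Ioo.ae_eq_zero_of_integral_contDiff_smul_eq_zero
    · exact IntegrableOn.locallyIntegrableOn ((integrable_L2 w).sub (integrable_L2 w'))
    · intro φ h1 h2 h3
      have hφ : IsTest ℓ φ := ⟨h1, h2, h3⟩
      have hz : ∀ x, x ∉ Ioo 0 ℓ → φ x • (w x - w' x) = 0 := by
        intro x hx
        rw [image_eq_zero_of_notMem_tsupport (fun hh => hx (h3 hh)), zero_smul]
      rw [← setIntegral_eq_integral_of_forall_compl_eq_zero hz]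
      simp_rw [smul_sub]
      rw [integral_sub (integrable_smul_L2 w h1.continuous h2)
        (integrable_smul_L2 w' h1.continuous h2)]
      have a1 := h φ hφ
      have a2 := h' φ hφ
      rw [a1] at a2
      rw [sub_eq_zero]
      exact neg_injective a2
  apply Lp.ext
  filter_upwards [(ae_restrict_iff' measurableSet_Ioo).2 key] with x hx
  exact sub_eq_zero.1 hx

theorem HasWeakDeriv.wderiv_eq {ℓ : ℝ} {u w : L2 ℓ E} (h : HasWeakDeriv ℓ u w) :
    wderiv ℓ u = w := h.isH1.hasWeakDeriv.unique h

/-- The primitive of `w` that vanishes at `0`. -/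
def prim (ℓ : ℝ) (w : L2 ℓ E) (x : ℝ) : E := ∫ t in (0 : ℝ)..x, (Ioo 0 ℓ).indicator w t

theorem integrable_indicator_L2 {ℓ : ℝ} (w : L2 ℓ E) :
    Integrable ((Ioo 0 ℓ).indicator w) volume :=
  (integrable_indicator_iff measurableSet_Ioo).2 (integrable_L2 w)

theorem continuous_prim {ℓ : ℝ} (w : L2 ℓ E) : Continuous (prim ℓ w) :=
  intervalIntegral.continuous_primitive (fun _ _ => (integrable_indicator_L2 w).intervalIntegrable) 0

theorem memLp_of_continuous {ℓ : ℝ} {g : ℝ → E} (hg : Continuous g) : MemLp g 2 (vol ℓ) := by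
  obtain ⟨C, hC⟩ := (isCompact_Icc (a := (0 : ℝ)) (b := ℓ)).exists_bound_of_continuousOn
    hg.continuousOn
  refine MemLp.of_bound hg.aestronglyMeasurable C ?_
  filter_upwards [ae_restrict_mem measurableSet_Ioo] with x hx
  exact hC x (Ioo_subset_Icc_self hx)

/-- The primitive as an element of `L²`. -/
def primL (ℓ : ℝ) (w : L2 ℓ E) : L2 ℓ E := (memLp_of_continuous (continuous_prim w)).toLp

theorem primL_ae {ℓ : ℝ} (w : L2 ℓ E) : primL ℓ w =ᵐ[vol ℓ] prim ℓ w := MemLp.coeFn_toLp _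

theorem IsTest.zero {ℓ : ℝ} {φ : ℝ → ℝ} (h : IsTest ℓ φ) {x : ℝ} (hx : x ∉ Ioo 0 ℓ) : φ x = 0 :=
  image_eq_zero_of_notMem_tsupport (fun hh => hx (h.2.2 hh))

theorem IsTest.integral_deriv {ℓ : ℝ} {φ : ℝ → ℝ} (h : IsTest ℓ φ) {t : ℝ} (ht : t ∈ Ioo 0 ℓ) :
    ∫ x in Ioo t ℓ, deriv φ x = - φ t := by
  rw [← integral_Ioc_eq_integral_Ioo, ← intervalIntegral.integral_of_le ht.2.le,
    intervalIntegral.integral_deriv_eq_sub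
    (fun x _ => (h.1.differentiable (by simp)).differentiableAt)
    (h.deriv_cont.1.intervalIntegrable _ _), h.zero (by simp), zero_sub]

theorem hasWeakDeriv_primL (ℓ : ℝ) (w : L2 ℓ E) : HasWeakDeriv ℓ (primL ℓ w) w := by
  intro φ hφ
  have e1 : ∫ x, deriv φ x • primL ℓ w x ∂(vol ℓ)
      = ∫ x, ∫ t, (Ioi t).indicator (deriv φ) x • w t ∂(vol ℓ) ∂(vol ℓ) := by
    apply integral_congr_ae
    filter_upwards [primL_ae w, ae_restrict_mem measurableSet_Ioo] with x hx hx0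
    rw [hx, prim, intervalIntegral.integral_of_le hx0.1.le, setIntegral_indicator measurableSet_Ioo,
      ← integral_smul]
    have : ∀ t, (Ioi t).indicator (deriv φ) x • w t = (Iio x).indicator (fun t => deriv φ x • w t) t := by
      intro t
      by_cases h : t < x
      · rw [indicator_of_mem (by exact h), indicator_of_mem (by exact h)]
      · rw [indicator_of_notMem (by exact h), indicator_of_notMem (by exact h), zero_smul]
    simp_rw [this]
    rw [integral_indicator measurableSet_Iio, Measure.restrict_restrict measurableSet_Iio]
    apply setIntegral_congr_set
    have h2 : Iio x ∩ Ioo 0 ℓ = Ioo 0 x := by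
      ext t; simp only [mem_inter_iff, mem_Iio, mem_Ioo] at *; constructor
      · rintro ⟨a, b, c⟩; exact ⟨b, a⟩
      · rintro ⟨a, b⟩; exact ⟨b, a, b.trans hx0.2⟩
    have h3 : Ioc 0 x ∩ Ioo 0 ℓ = Ioc 0 x := by
      apply inter_eq_left.2
      rintro t ⟨a, b⟩
      exact ⟨a, b.trans_lt hx0.2⟩
    rw [h2, h3]
    exact Ioo_ae_eq_Ioc.symm
  rw [e1, integral_integral_swap, ← integral_neg]
  · apply integral_congr_ae
    filter_upwards [ae_restrict_mem measurableSet_Ioo] with t ht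
    rw [integral_smul_const, integral_indicator measurableSet_Ioi,
      Measure.restrict_restrict measurableSet_Ioi]
    have h2 : Ioi t ∩ Ioo 0 ℓ = Ioo t ℓ := by
      ext x; simp only [mem_inter_iff, mem_Ioi, mem_Ioo] at *; constructor
      · rintro ⟨a, b, c⟩; exact ⟨a, c⟩
      · rintro ⟨a, b⟩; exact ⟨a, ht.1.trans a, b⟩
    rw [h2, hφ.integral_deriv ht, neg_smul]
  · obtain ⟨C, hC⟩ := hφ.deriv_cont.1.bounded_above_of_compact_support hφ.deriv_cont.2
    have hw : Integrable (fun q : ℝ × ℝ => w q.2) ((vol ℓ).prod (vol ℓ)) :=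
      (integrable_L2 w).comp_snd (vol ℓ)
    have hm : Measurable (fun q : ℝ × ℝ => (Ioi q.2).indicator (deriv φ) q.1) := by
      have : (fun q : ℝ × ℝ => (Ioi q.2).indicator (deriv φ) q.1)
          = {q : ℝ × ℝ | q.2 < q.1}.indicator (fun q => deriv φ q.1) := by
        ext q
        by_cases h : q.2 < q.1
        · rw [indicator_of_mem (by exact h), indicator_of_mem (by exact h)]
        · rw [indicator_of_notMem (by exact h), indicator_of_notMem (by exact h)]
      rw [this]
      exact (hφ.deriv_cont.1.measurable.comp measurable_fst).indicator
        (measurableSet_lt measurable_snd measurable_fst)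
    refine hw.bdd_smul (𝕜 := ℝ) C hm.aestronglyMeasurable (Eventually.of_forall fun q => ?_)
    exact (norm_indicator_le_norm_self _ _).trans (hC _)

theorem exists_bump {ℓ : ℝ} (hℓ : 0 < ℓ) : ∃ χ : ℝ → ℝ, IsTest ℓ χ ∧ ∫ x, χ x = 1 := by
  let f : ContDiffBump (ℓ / 2 : ℝ) := ⟨ℓ / 8, ℓ / 4, by positivity, by linarith⟩
  refine ⟨f.normed volume, ⟨f.contDiff_normed, f.hasCompactSupport_normed, ?_⟩, f.integral_normed⟩
  rw [f.tsupport_normed_eq, Real.closedBall_eq_Icc]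
  apply Icc_subset_Ioo
  · change 0 < ℓ / 2 - ℓ / 4; linarith
  · change ℓ / 2 + ℓ / 4 < ℓ; linarith

theorem isTest_primitive {ℓ : ℝ} (hℓ : 0 < ℓ) {θ : ℝ → ℝ} (h : IsTest ℓ θ) (h0 : ∫ x, θ x = 0) :
    IsTest ℓ (fun x => ∫ t in (0 : ℝ)..x, θ t) ∧ deriv (fun x => ∫ t in (0 : ℝ)..x, θ t) = θ := by
  have hc : Continuous θ := h.1.continuous
  have hd : deriv (fun x => ∫ t in (0 : ℝ)..x, θ t) = θ := by
    ext x
    exact Continuous.deriv_integral θ hc 0 x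
  have hdiff : Differentiable ℝ (fun x => ∫ t in (0 : ℝ)..x, θ t) := fun x =>
    (hc.integral_hasStrictDerivAt 0 x).hasDerivAt.differentiableAt
  have hcs : IsCompact (tsupport θ) := h.2.1
  obtain ⟨a, b, ha, hb, hab⟩ : ∃ a b, 0 < a ∧ b < ℓ ∧ tsupport θ ⊆ Icc a b := by
    by_cases hne : (tsupport θ).Nonempty
    · obtain ⟨a, ha, ha'⟩ := hcs.exists_isLeast hne
      obtain ⟨b, hb, hb'⟩ := hcs.exists_isGreatest hne
      exact ⟨a, b, (h.2.2 ha).1, (h.2.2 hb).2, fun x hx => ⟨ha' hx, hb' hx⟩⟩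
    · rw [not_nonempty_iff_eq_empty] at hne
      exact ⟨ℓ, 0, hℓ, hℓ, by rw [hne]; exact empty_subset _⟩
  have hz : ∀ x, x ∉ Icc a b → θ x = 0 := fun x hx =>
    image_eq_zero_of_notMem_tsupport (fun hh => hx (hab hh))
  have hint : Integrable θ volume := hc.integrable_of_hasCompactSupport h.2.1
  have hsub : tsupport (fun x => ∫ t in (0 : ℝ)..x, θ t) ⊆ Icc a b := by
    apply closure_minimal _ isClosed_Icc
    intro x hx
    by_contra hx'
    apply hx
    change ∫ t in (0 : ℝ)..x, θ t = 0
    by_cases hxa : x < a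
    · apply intervalIntegral.integral_zero_ae
      refine Eventually.of_forall fun t ht => hz t fun hh => ?_
      have : t ≤ max 0 x := ht.2
      rcases le_max_iff.1 this with h1 | h1
      · exact absurd hh.1 (not_le.2 (lt_of_le_of_lt h1 ha))
      · exact absurd hh.1 (not_le.2 (lt_of_le_of_lt h1 hxa))
    · have hxb : b < x := by
        by_contra hxb
        exact hx' ⟨not_lt.1 hxa, not_lt.1 hxb⟩
      have hx0 : 0 ≤ x := ha.le.trans (not_lt.1 hxa)
      rw [intervalIntegral.integral_of_le hx0, setIntegral_eq_integral_of_forall_compl_eq_zero, h0]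
      intro t ht
      refine hz t fun hh => ht ⟨ha.trans_le hh.1, hh.2.trans hxb.le⟩
  refine ⟨⟨?_, ?_, hsub.trans (Icc_subset_Ioo ha hb)⟩, hd⟩
  · rw [contDiff_infty_iff_deriv, hd]
    exact ⟨hdiff, h.1⟩
  · exact HasCompactSupport.intro (isCompact_Icc (a := a) (b := b)) fun x hx => by
      by_contra hne
      exact hx (hsub (subset_tsupport _ hne))

theorem IsTest.setIntegral {ℓ : ℝ} {φ : ℝ → ℝ} (h : IsTest ℓ φ) :
    ∫ x, φ x ∂(vol ℓ) = ∫ x, φ x :=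
  setIntegral_eq_integral_of_forall_compl_eq_zero fun _ hx => h.zero hx

/-- A function with vanishing weak derivative is constant. -/
theorem HasWeakDeriv.const_of_zero {ℓ : ℝ} (hℓ : 0 < ℓ) {u : L2 ℓ E} (h : HasWeakDeriv ℓ u 0) :
    ∃ c : E, u =ᵐ[vol ℓ] fun _ => c := by
  obtain ⟨χ, hχ, hχ1⟩ := exists_bump hℓ
  refine ⟨∫ x, χ x • u x ∂(vol ℓ), ?_⟩
  set c := ∫ x, χ x • u x ∂(vol ℓ) with hc
  have key : ∀ᵐ x ∂(volume : Measure ℝ), x ∈ Ioo 0 ℓ → (u x - c) = 0 := by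
    apply isOpen_Ioo.ae_eq_zero_of_integral_contDiff_smul_eq_zero
    · exact IntegrableOn.locallyIntegrableOn ((integrable_L2 u).sub (integrable_const c))
    · intro ψ h1 h2 h3
      have hψ : IsTest ℓ ψ := ⟨h1, h2, h3⟩
      have hz : ∀ x, x ∉ Ioo 0 ℓ → ψ x • (u x - c) = 0 := by
        intro x hx
        rw [hψ.zero hx, zero_smul]
      rw [← setIntegral_eq_integral_of_forall_compl_eq_zero hz]
      set m := ∫ x, ψ x with hm
      have hψi : Integrable ψ volume := h1.continuous.integrable_of_hasCompactSupport h2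
      have hχi : Integrable χ volume := hχ.1.continuous.integrable_of_hasCompactSupport hχ.2.1
      have hθ : IsTest ℓ (fun x => ψ x - m * χ x) := by
        refine ⟨h1.sub (contDiff_const.mul hχ.1), ?_, ?_⟩
        · exact h2.sub (hχ.2.1.mul_left (f := fun _ => m))
        · exact (tsupport_sub ψ (fun x => m * χ x)).trans (union_subset h3
            ((tsupport_mul_subset_right (f := fun _ => m) (g := χ)).trans hχ.2.2))
      have hθ0 : ∫ x, (ψ x - m * χ x) = 0 := by
        rw [integral_sub hψi (hχi.const_mul m), integral_const_mul, hχ1, mul_one, sub_self]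
      obtain ⟨ht, hd⟩ := isTest_primitive hℓ hθ hθ0
      have e := h _ ht
      rw [hd] at e
      have e0 : ∫ x, (∫ t in (0 : ℝ)..x, (ψ t - m * χ t)) • (0 : L2 ℓ E) x ∂(vol ℓ) = 0 := by
        apply integral_eq_zero_of_ae
        filter_upwards [Lp.coeFn_zero E 2 (vol ℓ)] with x hx
        rw [hx, Pi.zero_apply, smul_zero]
      rw [e0, neg_zero] at e
      simp_rw [sub_smul, mul_smul] at e
      have hi : Integrable (fun x => m • χ x • u x) (vol ℓ) :=
        (integrable_smul_L2 u hχ.1.continuous hχ.2.1).smul m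
      rw [integral_sub (integrable_smul_L2 u h1.continuous h2) hi, integral_smul, ← hc] at e
      simp_rw [smul_sub]
      rw [integral_sub (integrable_smul_L2 u h1.continuous h2) (hψi.restrict.smul_const c),
        integral_smul_const, hψ.setIntegral, ← hm]
      exact e
  filter_upwards [(ae_restrict_iff' measurableSet_Ioo).2 key] with x hx
  exact sub_eq_zero.1 hx

/-- The fundamental theorem of calculus for weakly differentiable functions. -/
theorem HasWeakDeriv.ae_eq_prim {ℓ : ℝ} (hℓ : 0 < ℓ) {u w : L2 ℓ E} (h : HasWeakDeriv ℓ u w) :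
    ∃ c : E, u =ᵐ[vol ℓ] fun x => c + prim ℓ w x := by
  have h0 := h.add ((hasWeakDeriv_primL ℓ w).smul (-1))
  have hw : w + (-1 : ℂ) • w = 0 := by rw [neg_one_smul, add_neg_cancel]
  rw [hw] at h0
  obtain ⟨c, hc⟩ := h0.const_of_zero hℓ
  refine ⟨c, ?_⟩
  filter_upwards [hc, Lp.coeFn_add u ((-1 : ℂ) • primL ℓ w), Lp.coeFn_smul (-1 : ℂ) (primL ℓ w),
    primL_ae w] with x h1 h2 h3 h4
  rw [h1, Pi.add_apply, h3, Pi.smul_apply, h4, neg_one_smul] at h2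
  rw [h2, neg_add_cancel_right]

theorem IsH1.exists_hasTrace {ℓ : ℝ} (hℓ : 0 < ℓ) {u : L2 ℓ E} (h : IsH1 ℓ u) (x : ℝ) :
    ∃ e, HasTrace ℓ u x e := by
  obtain ⟨w, hw⟩ := h
  obtain ⟨c, hc⟩ := hw.ae_eq_prim hℓ
  exact ⟨_, _, (continuous_const.add (continuous_prim w)).continuousOn, hc, rfl⟩

theorem IsH1.hasTrace {ℓ : ℝ} (hℓ : 0 < ℓ) {u : L2 ℓ E} (h : IsH1 ℓ u) (x : ℝ) :
    HasTrace ℓ u x (trace ℓ u x) := by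
  have h' := h.exists_hasTrace hℓ x
  rw [trace, dif_pos h']
  exact h'.choose_spec

theorem HasWeakDeriv.ae_eq_prim_of_trace {ℓ : ℝ} (hℓ : 0 < ℓ) {u w : L2 ℓ E}
    (h : HasWeakDeriv ℓ u w) (h0 : HasTrace ℓ u 0 0) : u = primL ℓ w := by
  obtain ⟨c, hc⟩ := h.ae_eq_prim hℓ
  have h1 : HasTrace ℓ u 0 (c + prim ℓ w 0) :=
    ⟨_, (continuous_const.add (continuous_prim w)).continuousOn, hc, rfl⟩
  have h2 : c + prim ℓ w 0 = 0 := h1.unique ⟨le_rfl, hℓ.le⟩ hℓ h0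
  rw [prim, intervalIntegral.integral_same, add_zero] at h2
  apply Lp.ext
  filter_upwards [hc, primL_ae w] with x h3 h4
  rw [h3, h4, h2, zero_add]

theorem wderiv_add {ℓ : ℝ} {u v : L2 ℓ E} (hu : IsH1 ℓ u) (hv : IsH1 ℓ v) :
    wderiv ℓ (u + v) = wderiv ℓ u + wderiv ℓ v :=
  (hu.hasWeakDeriv.add hv.hasWeakDeriv).wderiv_eq

theorem wderiv_smul {ℓ : ℝ} (c : ℂ) {u : L2 ℓ E} (hu : IsH1 ℓ u) :
    wderiv ℓ (c • u) = c • wderiv ℓ u :=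
  (hu.hasWeakDeriv.smul c).wderiv_eq

end Weak

/-- The functions of `H¹(0, ℓ)` (with complex values) that vanish at every point of `Z`. -/
def h1Van (ℓ : ℝ) (Z : Set ℝ) : Submodule ℂ (L2 ℓ ℂ) where
  carrier := {u | IsH1 ℓ u ∧ ∀ x ∈ Z, HasTrace ℓ u x 0}
  zero_mem' := ⟨(HasWeakDeriv.zero ℓ).isH1, fun x _ => HasTrace.zero ℓ x⟩
  add_mem' := by
    rintro u v ⟨hu, hu'⟩ ⟨hv, hv'⟩
    refine ⟨(hu.hasWeakDeriv.add hv.hasWeakDeriv).isH1, fun x hx => ?_⟩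
    simpa using (hu' x hx).add (hv' x hx)
  smul_mem' := by
    rintro c u ⟨hu, hu'⟩
    refine ⟨(hu.hasWeakDeriv.smul c).isH1, fun x hx => ?_⟩
    simpa using (hu' x hx).smul c

/-- The space of all `u` in `H¹(0, ℓ)` with `u(0) = 0` and `u(x) = 0` for `x` in `Z`,
which is normed below by the `L²` norm of the derivative. -/
def H1Van (ℓ : ℝ) (Z : Set ℝ) : Type := ↥(h1Van ℓ (insert 0 Z))

namespace H1Van

variable {ℓ : ℝ} {Z : Set ℝ}

instance : AddCommGroup (H1Van ℓ Z) := inferInstanceAs (AddCommGroup ↥(h1Van ℓ (insert 0 Z)))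

instance : Module ℂ (H1Van ℓ Z) := inferInstanceAs (Module ℂ ↥(h1Van ℓ (insert 0 Z)))

/-- The inclusion into `L²(0, ℓ)`. -/
def val : H1Van ℓ Z →ₗ[ℂ] L2 ℓ ℂ := (h1Van ℓ (insert 0 Z)).subtype

/-- An element of `L²(0, ℓ)` that lies in the space. -/
def mk (u : L2 ℓ ℂ) (h : u ∈ h1Van ℓ (insert 0 Z)) : H1Van ℓ Z := ⟨u, h⟩

theorem val_mk (u : L2 ℓ ℂ) (h : u ∈ h1Van ℓ (insert 0 Z)) : val (mk u h) = u := rfl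

theorem val_mem (u : H1Van ℓ Z) : val u ∈ h1Van ℓ (insert 0 Z) := u.2

theorem val_injective : Function.Injective (val : H1Van ℓ Z → L2 ℓ ℂ) := Subtype.val_injective

/-- The weak derivative `u ↦ u_x`. -/
def dx : H1Van ℓ Z →ₗ[ℂ] L2 ℓ ℂ where
  toFun u := wderiv ℓ (val u)
  map_add' u v := by rw [map_add, wderiv_add u.val_mem.1 v.val_mem.1]
  map_smul' c u := by rw [map_smul, wderiv_smul c u.val_mem.1, RingHom.id_apply]

theorem hasWeakDeriv (u : H1Van ℓ Z) : HasWeakDeriv ℓ (val u) (dx u) := u.val_mem.1.hasWeakDeriv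

theorem vol_eq_zero (h : ¬ 0 < ℓ) : vol ℓ = 0 := by
  rw [vol, Ioo_eq_empty h, Measure.restrict_empty]

theorem L2_eq (h : ¬ 0 < ℓ) (u v : L2 ℓ ℂ) : u = v := by
  have h0 : ∀ᵐ _ ∂(vol ℓ), False := by
    rw [vol_eq_zero h, ae_zero]
    exact eventually_bot
  apply Lp.ext
  filter_upwards [h0] with x hx
  exact hx.elim

theorem val_eq_primL (hℓ : 0 < ℓ) (u : H1Van ℓ Z) : val u = primL ℓ (dx u) :=
  u.hasWeakDeriv.ae_eq_prim_of_trace hℓ (u.val_mem.2 0 (mem_insert _ _))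

theorem dx_injective : Function.Injective (dx : H1Van ℓ Z → L2 ℓ ℂ) := by
  intro u v h
  apply val_injective
  by_cases hℓ : 0 < ℓ
  · rw [val_eq_primL hℓ, val_eq_primL hℓ, h]
  · exact L2_eq hℓ _ _

/-- The inner product `∫ u_x conj(v_x)` (Mathlib's `inner ℂ` is linear in its second argument). -/
abbrev core : InnerProductSpace.Core ℂ (H1Van ℓ Z) where
  inner u v := inner ℂ (dx u) (dx v)
  conj_inner_symm u v := inner_conj_symm _ _
  re_inner_nonneg u := inner_self_nonneg
  add_left u v w := by rw [map_add, inner_add_left]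
  smul_left u v c := by rw [map_smul, inner_smul_left]
  definite u h := dx_injective (by rw [inner_self_eq_zero.1 h, map_zero])

instance : NormedAddCommGroup (H1Van ℓ Z) := core.toNormedAddCommGroup

instance : InnerProductSpace ℂ (H1Van ℓ Z) := InnerProductSpace.ofCore core.toCore

theorem inner_def (u v : H1Van ℓ Z) : inner ℂ u v = inner ℂ (dx u) (dx v) := rfl

theorem norm_dx (u : H1Van ℓ Z) : ‖dx u‖ = ‖u‖ := by
  rw [norm_eq_sqrt_re_inner (𝕜 := ℂ), norm_eq_sqrt_re_inner (𝕜 := ℂ) u, inner_def]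

theorem prim_eq_inner (w : L2 ℓ ℂ) {x : ℝ} (hx : x ∈ Icc 0 ℓ) :
    prim ℓ w x = inner ℂ (indicatorConstLp 2 (μ := vol ℓ) (measurableSet_Ioc (a := (0 : ℝ)) (b := x))
      (measure_ne_top _ _) (1 : ℂ)) w := by
  rw [L2.inner_indicatorConstLp_one, prim, intervalIntegral.integral_of_le hx.1,
    setIntegral_indicator measurableSet_Ioo, Measure.restrict_restrict measurableSet_Ioc]

theorem mem_range_dx (hℓ : 0 < ℓ) (w : L2 ℓ ℂ) :
    w ∈ range (dx : H1Van ℓ Z → L2 ℓ ℂ) ↔ ∀ x ∈ Z ∩ Icc 0 ℓ, prim ℓ w x = 0 := by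
  constructor
  · rintro ⟨u, rfl⟩ x hx
    have h1 : HasTrace ℓ (val u) x (prim ℓ (dx u) x) :=
      ⟨_, (continuous_prim (dx u)).continuousOn, by
        rw [val_eq_primL hℓ]; exact primL_ae _, rfl⟩
    exact h1.unique hx.2 hℓ (u.val_mem.2 x (mem_insert_of_mem _ hx.1))
  · intro h
    have hm : primL ℓ w ∈ h1Van ℓ (insert 0 Z) := by
      refine ⟨(hasWeakDeriv_primL ℓ w).isH1, fun x hx => ?_⟩
      refine ⟨(Icc 0 ℓ).indicator (prim ℓ w), ?_, ?_, ?_⟩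
      · exact (continuous_prim w).continuousOn.congr fun y hy => indicator_of_mem hy _
      · filter_upwards [primL_ae w, ae_restrict_mem measurableSet_Ioo] with y h1 h2
        rw [h1, indicator_of_mem (Ioo_subset_Icc_self h2)]
      · by_cases hxI : x ∈ Icc 0 ℓ
        · rw [indicator_of_mem hxI]
          rcases hx with rfl | hx
          · exact intervalIntegral.integral_same
          · exact h x ⟨hx, hxI⟩
        · exact indicator_of_notMem hxI _
    exact ⟨mk _ hm, (hasWeakDeriv_primL ℓ w).wderiv_eq⟩

instance : CompleteSpace (H1Van ℓ Z) := by
  have hi : Isometry (dx : H1Van ℓ Z → L2 ℓ ℂ) :=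
    AddMonoidHomClass.isometry_of_norm (dx : H1Van ℓ Z →ₗ[ℂ] L2 ℓ ℂ) norm_dx
  rw [completeSpace_iff_isComplete_range hi.isUniformInducing]
  apply IsClosed.isComplete
  by_cases hℓ : 0 < ℓ
  · have : range (dx : H1Van ℓ Z → L2 ℓ ℂ)
        = ⋂ x ∈ Z ∩ Icc 0 ℓ, {w | prim ℓ w x = 0} := by
      ext w
      rw [mem_range_dx hℓ, mem_iInter₂]
      rfl
    rw [this]
    refine isClosed_biInter fun x hx => ?_
    simp_rw [prim_eq_inner _ hx.2]
    exact isClosed_eq (continuous_const.inner continuous_id) continuous_const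
  · have : range (dx : H1Van ℓ Z → L2 ℓ ℂ) = univ :=
      eq_univ_of_forall fun w => ⟨0, L2_eq hℓ _ _⟩
    rw [this]
    exact isClosed_univ

end H1Van

/-- `H¹₀(0, ℓ)`, with the inner product `∫ u_x conj(v_x)`. -/
abbrev H10 (ℓ : ℝ) : Type := H1Van ℓ {ℓ}

/-- `H¹_L(0, ℓ)`, the functions of `H¹(0, ℓ)` that vanish at `0`, with the inner product
`∫ u_x conj(v_x)`. -/
abbrev H1L (ℓ : ℝ) : Type := H1Van ℓ ∅

/-- The constants of the system, with the standing assumptions on them. -/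
structure Params where
  L : ℝ
  a : ℝ
  τ : ℝ
  κ₁ : ℝ
  κ₂ : ℝ
  α : ℝ
  β : ℝ
  γ : ℝ
  c₀ : ℝ
  a_pos : 0 < a
  τ_pos : 0 < τ
  κ₁_pos : 0 < κ₁
  κ₂_ne : κ₂ ≠ 0
  α_pos : 0 < α
  α_lt_β : α < β
  β_lt_γ : β < γ
  γ_lt_L : γ < L
  c₀_pos : 0 < c₀

namespace Params

/-- The hypothesis (H). -/
def HypH (p : Params) : Prop := 0 < p.κ₁ ∧ p.κ₂ ≠ 0 ∧ |p.κ₂| < p.κ₁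

/-- The damping coefficient `b`. -/
def b (p : Params) : ℝ → ℝ := (Ioo 0 p.β).indicator fun _ => 1

/-- The coupling coefficient `c`. -/
def c (p : Params) : ℝ → ℝ := (Ioo p.α p.γ).indicator fun _ => p.c₀

theorem β_lt_L (p : Params) : p.β < p.L := p.β_lt_γ.trans p.γ_lt_L

end Params

/-- The space `L²((0, 1); H¹_L(0, β))`; its inner product is
`∫_{(0,1)} ∫_{(0,β)} η_x conj(ζ_x) dx dρ`. -/
abbrev W (p : Params) := L2 1 (H1L p.β)

/-- The energy space `(H¹₀(0, L) × L²(0, L))² × L²((0, 1); H¹_L(0, β))`. -/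
def Energy (p : Params) : Type := H10 p.L × L2 p.L ℂ × H10 p.L × L2 p.L ℂ × W p

namespace Energy

variable {p : Params}

instance : AddCommGroup (Energy p) :=
  inferInstanceAs (AddCommGroup (H10 p.L × L2 p.L ℂ × H10 p.L × L2 p.L ℂ × W p))

instance : Module ℂ (Energy p) :=
  inferInstanceAs (Module ℂ (H10 p.L × L2 p.L ℂ × H10 p.L × L2 p.L ℂ × W p))

/-- The state with components `(u, v, y, z, η)`. -/
def mk (u : H10 p.L) (v : L2 p.L ℂ) (y : H10 p.L) (z : L2 p.L ℂ) (η : W p) : Energy p :=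
  (u, v, y, z, η)

/-- The component `u` of a state `(u, v, y, z, η)`. -/
def u : Energy p →ₗ[ℂ] H10 p.L where
  toFun U := Prod.fst U
  map_add' _ _ := rfl
  map_smul' _ _ := rfl

/-- The component `v` of a state `(u, v, y, z, η)`. -/
def v : Energy p →ₗ[ℂ] L2 p.L ℂ where
  toFun U := U.2.1
  map_add' _ _ := rfl
  map_smul' _ _ := rfl

/-- The component `y` of a state `(u, v, y, z, η)`. -/
def y : Energy p →ₗ[ℂ] H10 p.L where
  toFun U := U.2.2.1
  map_add' _ _ := rfl
  map_smul' _ _ := rfl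

/-- The component `z` of a state `(u, v, y, z, η)`. -/
def z : Energy p →ₗ[ℂ] L2 p.L ℂ where
  toFun U := U.2.2.2.1
  map_add' _ _ := rfl
  map_smul' _ _ := rfl

/-- The component `η` of a state `(u, v, y, z, η)`. -/
def η : Energy p →ₗ[ℂ] W p where
  toFun U := U.2.2.2.2
  map_add' _ _ := rfl
  map_smul' _ _ := rfl

theorem ext' {U V : Energy p} (h1 : u U = u V) (h2 : v U = v V) (h3 : y U = y V)
    (h4 : z U = z V) (h5 : η U = η V) : U = V :=
  Prod.ext h1 (Prod.ext h2 (Prod.ext h3 (Prod.ext h4 h5)))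

theorem weight_pos (p : Params) : 0 < p.τ * |p.κ₂| := mul_pos p.τ_pos (abs_pos.2 p.κ₂_ne)

/-- The energy inner product
`∫ (a u_x conj(u¹_x) + v conj(v¹) + y_x conj(y¹_x) + z conj(z¹)) dx
  + τ |κ₂| ∫∫ η_x conj(η¹_x) dρ dx`. -/
abbrev core : InnerProductSpace.Core ℂ (Energy p) where
  inner U V := (p.a : ℂ) * inner ℂ (u U) (u V) + inner ℂ (v U) (v V) + inner ℂ (y U) (y V)
    + inner ℂ (z U) (z V) + ((p.τ * |p.κ₂| : ℝ) : ℂ) * inner ℂ (η U) (η V)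
  conj_inner_symm U V := by
    simp only [map_add, map_mul, Complex.conj_ofReal, inner_conj_symm]
  re_inner_nonneg U := by
    simp only [map_add, RCLike.re_to_complex, Complex.re_ofReal_mul]
    have h1 := inner_self_nonneg (𝕜 := ℂ) (x := u U)
    have h2 := inner_self_nonneg (𝕜 := ℂ) (x := v U)
    have h3 := inner_self_nonneg (𝕜 := ℂ) (x := y U)
    have h4 := inner_self_nonneg (𝕜 := ℂ) (x := z U)
    have h5 := inner_self_nonneg (𝕜 := ℂ) (x := η U)
    simp only [RCLike.re_to_complex] at h1 h2 h3 h4 h5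
    have h6 := mul_nonneg p.a_pos.le h1
    have h7 := mul_nonneg (weight_pos p).le h5
    linarith
  add_left U V X := by
    simp only [map_add, inner_add_left]
    ring
  smul_left U V c := by
    simp only [map_smul, inner_smul_left]
    ring
  definite U h := by
    have h0 := congrArg Complex.re h
    simp only [Complex.add_re, Complex.re_ofReal_mul, Complex.zero_re] at h0
    have h1 := inner_self_nonneg (𝕜 := ℂ) (x := u U)
    have h2 := inner_self_nonneg (𝕜 := ℂ) (x := v U)
    have h3 := inner_self_nonneg (𝕜 := ℂ) (x := y U)
    have h4 := inner_self_nonneg (𝕜 := ℂ) (x := z U)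
    have h5 := inner_self_nonneg (𝕜 := ℂ) (x := η U)
    simp only [RCLike.re_to_complex] at h1 h2 h3 h4 h5
    have h6 := mul_nonneg p.a_pos.le h1
    have h7 := mul_nonneg (weight_pos p).le h5
    have zero_of : ∀ {X : Type} [NormedAddCommGroup X] [InnerProductSpace ℂ X] (x : X),
        (inner ℂ x x).re = 0 → x = 0 := by
      intro X _ _ x hx
      exact (inner_self_eq_zero (𝕜 := ℂ)).1 (by
        rw [← inner_self_ofReal_re (𝕜 := ℂ) x, RCLike.re_to_complex, hx]; rfl)
    apply ext'
    · rw [map_zero]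
      refine zero_of _ ?_
      have : p.a * (inner ℂ (u U) (u U)).re = 0 := by linarith
      exact (mul_eq_zero.1 this).resolve_left p.a_pos.ne'
    · rw [map_zero]; exact zero_of _ (by linarith)
    · rw [map_zero]; exact zero_of _ (by linarith)
    · rw [map_zero]; exact zero_of _ (by linarith)
    · rw [map_zero]
      refine zero_of _ ?_
      have : p.τ * |p.κ₂| * (inner ℂ (η U) (η U)).re = 0 := by linarith
      exact (mul_eq_zero.1 this).resolve_left (weight_pos p).ne'

instance : NormedAddCommGroup (Energy p) := core.toNormedAddCommGroup

instance : InnerProductSpace ℂ (Energy p) := InnerProductSpace.ofCore core.toCore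

theorem inner_def (U V : Energy p) : inner ℂ U V =
    (p.a : ℂ) * inner ℂ (u U) (u V) + inner ℂ (v U) (v V) + inner ℂ (y U) (y V)
    + inner ℂ (z U) (z V) + ((p.τ * |p.κ₂| : ℝ) : ℂ) * inner ℂ (η U) (η V) := rfl

theorem norm_sq (U : Energy p) : ‖U‖ ^ 2 = p.a * ‖u U‖ ^ 2 + ‖v U‖ ^ 2 + ‖y U‖ ^ 2 + ‖z U‖ ^ 2
    + p.τ * |p.κ₂| * ‖η U‖ ^ 2 := by
  simp only [← inner_self_eq_norm_sq (𝕜 := ℂ), inner_def, map_add, RCLike.re_to_complex,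
    Complex.re_ofReal_mul]

instance : CompleteSpace (Energy p) := by
  let e : Energy p →ₗ[ℂ] (H10 p.L × L2 p.L ℂ × H10 p.L × L2 p.L ℂ × W p) :=
    { toFun := fun U => (u U, v U, y U, z U, η U)
      map_add' := fun _ _ => rfl
      map_smul' := fun _ _ => rfl }
  have hb : ∀ (k : ℝ), 0 < k → ∀ s t : ℝ, 0 ≤ s → 0 ≤ t → k * s ^ 2 ≤ t ^ 2 →
      s ≤ (√k)⁻¹ * t := by
    intro k hk s t hs ht h
    rw [inv_mul_eq_div, le_div_iff₀ (Real.sqrt_pos.2 hk), ← Real.sqrt_sq hs, ← Real.sqrt_mul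
      (sq_nonneg s), mul_comm]
    exact Real.sqrt_le_iff.2 ⟨ht, h⟩
  have hw := weight_pos p
  have ha := p.a_pos
  obtain ⟨C, hC0, hC⟩ : ∃ C : ℝ, 0 ≤ C ∧ ∀ U : Energy p, ‖e U‖ ≤ C * ‖U‖ := by
    refine ⟨(√p.a)⁻¹ + 1 + (√(p.τ * |p.κ₂|))⁻¹, by positivity, fun U => ?_⟩
    have hU := norm_sq U
    have i1 : 0 ≤ p.a * ‖u U‖ ^ 2 := by positivity
    have i5 : 0 ≤ p.τ * |p.κ₂| * ‖η U‖ ^ 2 := by positivity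
    have i2 := sq_nonneg ‖v U‖
    have i3 := sq_nonneg ‖y U‖
    have i4 := sq_nonneg ‖z U‖
    have j1 := hb p.a ha ‖u U‖ ‖U‖ (norm_nonneg _) (norm_nonneg _) (by linarith)
    have j5 := hb _ hw ‖η U‖ ‖U‖ (norm_nonneg _) (norm_nonneg _) (by linarith)
    have j2 : ‖v U‖ ≤ ‖U‖ := abs_le_of_sq_le_sq' (by linarith) (norm_nonneg _) |>.2
    have j3 : ‖y U‖ ≤ ‖U‖ := abs_le_of_sq_le_sq' (by linarith) (norm_nonneg _) |>.2
    have j4 : ‖z U‖ ≤ ‖U‖ := abs_le_of_sq_le_sq' (by linarith) (norm_nonneg _) |>.2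
    have k1 : 0 ≤ (√p.a)⁻¹ * ‖U‖ := by positivity
    have k2 : 0 ≤ (√(p.τ * |p.κ₂|))⁻¹ * ‖U‖ := by positivity
    have k3 := norm_nonneg U
    change max ‖u U‖ (max ‖v U‖ (max ‖y U‖ (max ‖z U‖ ‖η U‖))) ≤ _
    rw [add_mul, add_mul, one_mul]
    refine max_le ?_ (max_le ?_ (max_le ?_ (max_le ?_ ?_))) <;> linarith
  have hlow : ∀ U : Energy p, ‖U‖ ≤ √(p.a + 3 + p.τ * |p.κ₂|) * ‖e U‖ := by
    intro U
    have hU := norm_sq U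
    have m1 : ‖u U‖ ≤ ‖e U‖ := le_max_left _ _
    have m2 : ‖v U‖ ≤ ‖e U‖ := le_max_of_le_right (le_max_left _ _)
    have m3 : ‖y U‖ ≤ ‖e U‖ := le_max_of_le_right (le_max_of_le_right (le_max_left _ _))
    have m4 : ‖z U‖ ≤ ‖e U‖ :=
      le_max_of_le_right (le_max_of_le_right (le_max_of_le_right (le_max_left _ _)))
    have m5 : ‖η U‖ ≤ ‖e U‖ :=
      le_max_of_le_right (le_max_of_le_right (le_max_of_le_right (le_max_right _ _)))
    have n1 := mul_le_mul_of_nonneg_left (pow_le_pow_left₀ (norm_nonneg _) m1 2) ha.le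
    have n2 := pow_le_pow_left₀ (norm_nonneg _) m2 2
    have n3 := pow_le_pow_left₀ (norm_nonneg _) m3 2
    have n4 := pow_le_pow_left₀ (norm_nonneg _) m4 2
    have n5 := mul_le_mul_of_nonneg_left (pow_le_pow_left₀ (norm_nonneg _) m5 2) hw.le
    rw [← Real.sqrt_sq (norm_nonneg (e U)), ← Real.sqrt_mul (by positivity)]
    apply Real.le_sqrt_of_sq_le
    linarith
  let E : Energy p ≃L[ℂ] (H10 p.L × L2 p.L ℂ × H10 p.L × L2 p.L ℂ × W p) :=
    { toLinearEquiv := LinearEquiv.ofBijective e ⟨fun U V h => h, fun q => ⟨q, rfl⟩⟩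
      continuous_toFun := (e.mkContinuous C hC).continuous
      continuous_invFun := by
        have : Continuous (LinearMap.mkContinuous
          (LinearEquiv.ofBijective e ⟨fun U V h => h, fun q => ⟨q, rfl⟩⟩).symm.toLinearMap
          (√(p.a + 3 + p.τ * |p.κ₂|)) (fun q => by
            have h := hlow ((LinearEquiv.ofBijective e ⟨fun U V h => h, fun q => ⟨q, rfl⟩⟩).symm q)
            have h' : e ((LinearEquiv.ofBijective e ⟨fun U V h => h, fun q => ⟨q, rfl⟩⟩).symm q) = q :=
              LinearEquiv.apply_symm_apply (LinearEquiv.ofBijective e _) q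
            rw [h'] at h
            exact h)) := ContinuousLinearMap.continuous _
        exact this }
  exact (completeSpace_congr (e := E.toEquiv) E.isUniformEmbedding).2 inferInstance

end Energy

/-- Multiplication by the coupling coefficient, `w ↦ c w`. -/
def mulC (p : Params) (w : L2 p.L ℂ) : L2 p.L ℂ :=
  MemLp.toLp (fun x => (p.c x : ℂ) * w x) (by
    have h : (fun x => (p.c x : ℂ) * w x) = (Ioo p.α p.γ).indicator fun x => (p.c₀ : ℂ) * w x := by
      ext x
      by_cases hx : x ∈ Ioo p.α p.γ
      · rw [indicator_of_mem hx, Params.c, indicator_of_mem hx]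
      · rw [indicator_of_notMem hx, Params.c, indicator_of_notMem hx, Complex.ofReal_zero, zero_mul]
    rw [h]
    exact ((Lp.memLp w).const_mul _).indicator measurableSet_Ioo)

theorem mulC_ae (p : Params) (w : L2 p.L ℂ) :
    mulC p w =ᵐ[vol p.L] fun x => (p.c x : ℂ) * w x := MemLp.coeFn_toLp _

/-- Restriction of a function on `(0, L)` to `(0, β)`. -/
def restr (p : Params) (w : L2 p.L ℂ) : L2 p.β ℂ :=
  MemLp.toLp w ((Lp.memLp w).mono_measure
    (Measure.restrict_mono (Ioo_subset_Ioo_right p.β_lt_L.le) le_rfl))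

theorem restr_ae (p : Params) (w : L2 p.L ℂ) : restr p w =ᵐ[vol p.β] w := MemLp.coeFn_toLp _

theorem ae_vol_β (p : Params) {P : ℝ → Prop} (h : ∀ᵐ x ∂(vol p.L), P x) : ∀ᵐ x ∂(vol p.β), P x :=
  ae_mono (Measure.restrict_mono (Ioo_subset_Ioo_right p.β_lt_L.le) le_rfl) h

/-- The function `a u_x + b (κ₁ v_x + κ₂ η_x(·, 1))` on `(0, L)`; the factor `b` vanishes outside
`(0, β)`, where `η_x(·, 1)` has no meaning. -/
def stressFun (p : Params) (u : H10 p.L) (v : L2 p.L ℂ) (η : W p) (x : ℝ) : ℂ :=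
  (p.a : ℂ) * H1Van.dx u x
    + (p.b x : ℂ) * ((p.κ₁ : ℂ) * wderiv p.L v x + (p.κ₂ : ℂ) * H1Van.dx (trace 1 η 1) x)

theorem memLp_stressFun (p : Params) (u : H10 p.L) (v : L2 p.L ℂ) (η : W p) :
    MemLp (stressFun p u v η) 2 (vol p.L) := by
  refine ((Lp.memLp (H1Van.dx u)).const_mul _).add ?_
  have h : (fun x => (p.b x : ℂ) * ((p.κ₁ : ℂ) * wderiv p.L v x
        + (p.κ₂ : ℂ) * H1Van.dx (trace 1 η 1) x))
      = (Ioo 0 p.β).indicator fun x => (p.κ₁ : ℂ) * wderiv p.L v x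
        + (p.κ₂ : ℂ) * H1Van.dx (trace 1 η 1) x := by
    ext x
    by_cases hx : x ∈ Ioo 0 p.β
    · rw [indicator_of_mem hx, Params.b, indicator_of_mem hx, Complex.ofReal_one, one_mul]
    · rw [indicator_of_notMem hx, Params.b, indicator_of_notMem hx, Complex.ofReal_zero, zero_mul]
  change MemLp (fun x => (p.b x : ℂ) * ((p.κ₁ : ℂ) * wderiv p.L v x
        + (p.κ₂ : ℂ) * H1Van.dx (trace 1 η 1) x)) 2 (vol p.L)
  rw [h, memLp_indicator_iff_restrict measurableSet_Ioo, Measure.restrict_restrict measurableSet_Ioo,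
    inter_eq_left.2 (Ioo_subset_Ioo_right p.β_lt_L.le)]
  refine MemLp.add (MemLp.const_mul ?_ _) ((Lp.memLp (H1Van.dx (trace 1 η 1))).const_mul _)
  exact (Lp.memLp (wderiv p.L v)).mono_measure
    (Measure.restrict_mono (Ioo_subset_Ioo_right p.β_lt_L.le) le_rfl)

/-- `S_b(u, v, η) = a u_x + b (κ₁ v_x + κ₂ η_x(·, 1))`. -/
def Sb (p : Params) (u : H10 p.L) (v : L2 p.L ℂ) (η : W p) : L2 p.L ℂ :=
  (memLp_stressFun p u v η).toLp

theorem Sb_ae (p : Params) (u : H10 p.L) (v : L2 p.L ℂ) (η : W p) :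
    Sb p u v η =ᵐ[vol p.L] stressFun p u v η := MemLp.coeFn_toLp _

theorem mulC_add (p : Params) (w w' : L2 p.L ℂ) : mulC p (w + w') = mulC p w + mulC p w' := by
  apply Lp.ext
  filter_upwards [mulC_ae p w, mulC_ae p w', mulC_ae p (w + w'), Lp.coeFn_add w w',
    Lp.coeFn_add (mulC p w) (mulC p w')] with x h1 h2 h3 h4 h5
  rw [h3, h5, h4, Pi.add_apply, Pi.add_apply, h1, h2, mul_add]

theorem mulC_smul (p : Params) (k : ℂ) (w : L2 p.L ℂ) : mulC p (k • w) = k • mulC p w := by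
  apply Lp.ext
  filter_upwards [mulC_ae p w, mulC_ae p (k • w), Lp.coeFn_smul k w,
    Lp.coeFn_smul k (mulC p w)] with x h1 h3 h4 h5
  rw [h3, h5, h4, Pi.smul_apply, Pi.smul_apply, h1, smul_eq_mul, smul_eq_mul, mul_left_comm]

theorem restr_add (p : Params) (w w' : L2 p.L ℂ) : restr p (w + w') = restr p w + restr p w' := by
  apply Lp.ext
  filter_upwards [restr_ae p w, restr_ae p w', restr_ae p (w + w'), ae_vol_β p (Lp.coeFn_add w w'),
    Lp.coeFn_add (restr p w) (restr p w')] with x h1 h2 h3 h4 h5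
  rw [h3, h5, h4, Pi.add_apply, Pi.add_apply, h1, h2]

theorem restr_smul (p : Params) (k : ℂ) (w : L2 p.L ℂ) : restr p (k • w) = k • restr p w := by
  apply Lp.ext
  filter_upwards [restr_ae p w, restr_ae p (k • w), ae_vol_β p (Lp.coeFn_smul k w),
    Lp.coeFn_smul k (restr p w)] with x h1 h3 h4 h5
  rw [h3, h5, h4, Pi.smul_apply, Pi.smul_apply, h1]

section Trace

variable {E : Type*} [NormedAddCommGroup E] [NormedSpace ℂ E] [CompleteSpace E]

theorem trace_add {x : ℝ} (hx : x ∈ Icc (0 : ℝ) 1) {η ζ : L2 1 E} (hη : IsH1 1 η)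
    (hζ : IsH1 1 ζ) : trace 1 (η + ζ) x = trace 1 η x + trace 1 ζ x :=
  ((hη.hasTrace one_pos x).add (hζ.hasTrace one_pos x)).trace_eq hx one_pos

theorem trace_smul {x : ℝ} (hx : x ∈ Icc (0 : ℝ) 1) (k : ℂ) {η : L2 1 E} (hη : IsH1 1 η) :
    trace 1 (k • η) x = k • trace 1 η x :=
  ((hη.hasTrace one_pos x).smul k).trace_eq hx one_pos

end Trace

/-- `b f` for two functions that agree almost everywhere on `(0, β)`. -/
theorem ae_b_mul (p : Params) {f g : ℝ → ℂ} (h : f =ᵐ[vol p.β] g) :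
    ∀ᵐ x ∂(vol p.L), (p.b x : ℂ) * f x = (p.b x : ℂ) * g x := by
  have h1 := ae_restrict_of_ae (s := Ioo 0 p.L) ((ae_restrict_iff' measurableSet_Ioo).1 h)
  filter_upwards [h1] with x hx
  by_cases hx' : x ∈ Ioo 0 p.β
  · rw [hx hx']
  · rw [Params.b, indicator_of_notMem hx', Complex.ofReal_zero, zero_mul, zero_mul]

theorem Sb_add (p : Params) (u u' : H10 p.L) {v v' : L2 p.L ℂ} {η η' : W p}
    (hv : IsH1 p.L v) (hv' : IsH1 p.L v') (hη : IsH1 1 η) (hη' : IsH1 1 η') :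
    Sb p (u + u') (v + v') (η + η') = Sb p u v η + Sb p u' v' η' := by
  apply Lp.ext
  have e1 := ae_b_mul p (Lp.coeFn_add (H1Van.dx (trace 1 η 1)) (H1Van.dx (trace 1 η' 1)))
  filter_upwards [Sb_ae p u v η, Sb_ae p u' v' η', Sb_ae p (u + u') (v + v') (η + η'),
    Lp.coeFn_add (Sb p u v η) (Sb p u' v' η'), Lp.coeFn_add (H1Van.dx u) (H1Van.dx u'),
    Lp.coeFn_add (wderiv p.L v) (wderiv p.L v'), e1] with x h1 h2 h3 h4 h5 h6 h7
  rw [h3, h4, Pi.add_apply, h1, h2, stressFun, stressFun, stressFun, map_add, h5,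
    wderiv_add hv hv', h6, trace_add (by simp) hη hη', map_add]
  simp only [Pi.add_apply] at h7 ⊢
  linear_combination (p.κ₂ : ℂ) * h7

theorem Sb_smul (p : Params) (k : ℂ) (u : H10 p.L) {v : L2 p.L ℂ} {η : W p}
    (hv : IsH1 p.L v) (hη : IsH1 1 η) :
    Sb p (k • u) (k • v) (k • η) = k • Sb p u v η := by
  apply Lp.ext
  have e1 := ae_b_mul p (Lp.coeFn_smul k (H1Van.dx (trace 1 η 1)))
  filter_upwards [Sb_ae p u v η, Sb_ae p (k • u) (k • v) (k • η),
    Lp.coeFn_smul k (Sb p u v η), Lp.coeFn_smul k (H1Van.dx u),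
    Lp.coeFn_smul k (wderiv p.L v), e1] with x h1 h3 h4 h5 h6 h7
  rw [h3, h4, Pi.smul_apply, h1, stressFun, stressFun, map_smul, h5,
    wderiv_smul k hv, h6, trace_smul (by simp) k hη, map_smul]
  simp only [Pi.smul_apply, smul_eq_mul] at h7 ⊢
  linear_combination (p.κ₂ : ℂ) * h7

/-- The domain `D(A)`: the states `(u, v, y, z, η)` with `y ∈ H²(0, L) ∩ H¹₀(0, L)`,
`v, z ∈ H¹₀(0, L)`, `(S_b(u, v, η))_x ∈ L²(0, L)`, `η_ρ ∈ L²((0, 1); H¹_L(0, β))` and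
`η(·, 0) = v` on `(0, β)`. -/
def domA (p : Params) : Submodule ℂ (Energy p) where
  carrier := {U | IsH1 p.L (H1Van.dx U.y) ∧ U.v ∈ h1Van p.L {0, p.L} ∧ U.z ∈ h1Van p.L {0, p.L} ∧
    IsH1 p.L (Sb p U.u U.v U.η) ∧ IsH1 1 U.η ∧ H1Van.val (trace 1 U.η 0) = restr p U.v}
  zero_mem' := by
    have h0 : IsH1 1 (0 : W p) := (HasWeakDeriv.zero 1).isH1
    refine ⟨?_, ?_, ?_, ?_, ?_, ?_⟩
    · rw [map_zero, map_zero]; exact (HasWeakDeriv.zero _).isH1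
    · rw [map_zero]; exact Submodule.zero_mem _
    · rw [map_zero]; exact Submodule.zero_mem _
    · have h := Sb_smul p 0 (0 : H10 p.L) (HasWeakDeriv.zero p.L).isH1 h0
      simp only [zero_smul] at h
      simp only [map_zero]
      rw [h]
      exact (HasWeakDeriv.zero _).isH1
    · rw [map_zero]; exact h0
    · have h := restr_smul p 0 0
      rw [zero_smul, zero_smul] at h
      rw [map_zero, map_zero, (HasTrace.zero 1 0).trace_eq (by simp) one_pos, map_zero, h]
  add_mem' := by
    rintro U V ⟨h1, h2, h3, h4, h5, h6⟩ ⟨k1, k2, k3, k4, k5, k6⟩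
    refine ⟨?_, ?_, ?_, ?_, ?_, ?_⟩
    · rw [map_add, map_add]; exact (h1.hasWeakDeriv.add k1.hasWeakDeriv).isH1
    · rw [map_add]; exact Submodule.add_mem _ h2 k2
    · rw [map_add]; exact Submodule.add_mem _ h3 k3
    · rw [map_add, map_add, map_add, Sb_add p _ _ h2.1 k2.1 h5 k5]
      exact (h4.hasWeakDeriv.add k4.hasWeakDeriv).isH1
    · rw [map_add]; exact (h5.hasWeakDeriv.add k5.hasWeakDeriv).isH1
    · rw [map_add, map_add, trace_add (by simp) h5 k5, map_add, h6, k6, restr_add]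
  smul_mem' := by
    rintro k U ⟨h1, h2, h3, h4, h5, h6⟩
    refine ⟨?_, ?_, ?_, ?_, ?_, ?_⟩
    · rw [map_smul, map_smul]; exact (h1.hasWeakDeriv.smul k).isH1
    · rw [map_smul]; exact Submodule.smul_mem _ k h2
    · rw [map_smul]; exact Submodule.smul_mem _ k h3
    · rw [map_smul, map_smul, map_smul, Sb_smul p k _ h2.1 h5]
      exact (h4.hasWeakDeriv.smul k).isH1
    · rw [map_smul]; exact (h5.hasWeakDeriv.smul k).isH1
    · rw [map_smul, map_smul, trace_smul (by simp) k h5, map_smul, h6, restr_smul]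

/-- The operator
`A (u, v, y, z, η) = (v, (S_b(u, v, η))_x - c z, z, y_xx + c v, -τ⁻¹ η_ρ)` with domain `D(A)`. -/
def opA (p : Params) : Energy p →ₗ.[ℂ] Energy p where
  domain := domA p
  toFun :=
    { toFun := fun U => Energy.mk
        (H1Van.mk (U : Energy p).v U.2.2.1)
        (wderiv p.L (Sb p (U : Energy p).u (U : Energy p).v (U : Energy p).η)
          - mulC p (U : Energy p).z)
        (H1Van.mk (U : Energy p).z U.2.2.2.1)
        (wderiv p.L (H1Van.dx (U : Energy p).y) + mulC p (U : Energy p).v)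
        (-((p.τ⁻¹ : ℝ) : ℂ) • wderiv 1 (U : Energy p).η)
      map_add' := by
        rintro ⟨U, h1, h2, h3, h4, h5, h6⟩ ⟨V, k1, k2, k3, k4, k5, k6⟩
        refine Energy.ext' ?_ ?_ ?_ ?_ ?_
        · rfl
        · change wderiv p.L (Sb p (Energy.u (U + V)) (Energy.v (U + V)) (Energy.η (U + V)))
            - mulC p (Energy.z (U + V)) = (wderiv p.L (Sb p U.u U.v U.η) - mulC p U.z)
            + (wderiv p.L (Sb p V.u V.v V.η) - mulC p V.z)
          rw [map_add, map_add, map_add, map_add, Sb_add p _ _ h2.1 k2.1 h5 k5, wderiv_add h4 k4,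
            mulC_add]
          abel
        · rfl
        · change wderiv p.L (H1Van.dx (Energy.y (U + V))) + mulC p (Energy.v (U + V))
            = (wderiv p.L (H1Van.dx U.y) + mulC p U.v) + (wderiv p.L (H1Van.dx V.y) + mulC p V.v)
          rw [map_add, map_add, map_add, wderiv_add h1 k1, mulC_add]
          abel
        · change -((p.τ⁻¹ : ℝ) : ℂ) • wderiv 1 (Energy.η (U + V))
            = -((p.τ⁻¹ : ℝ) : ℂ) • wderiv 1 U.η + -((p.τ⁻¹ : ℝ) : ℂ) • wderiv 1 V.η
          rw [map_add, wderiv_add h5 k5, smul_add]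
      map_smul' := by
        rintro k ⟨U, h1, h2, h3, h4, h5, h6⟩
        refine Energy.ext' ?_ ?_ ?_ ?_ ?_
        · rfl
        · change wderiv p.L (Sb p (Energy.u (k • U)) (Energy.v (k • U)) (Energy.η (k • U)))
            - mulC p (Energy.z (k • U)) = k • (wderiv p.L (Sb p U.u U.v U.η) - mulC p U.z)
          rw [map_smul, map_smul, map_smul, map_smul, Sb_smul p k _ h2.1 h5, wderiv_smul k h4,
            mulC_smul, smul_sub]
        · rfl
        · change wderiv p.L (H1Van.dx (Energy.y (k • U))) + mulC p (Energy.v (k • U))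
            = k • (wderiv p.L (H1Van.dx U.y) + mulC p U.v)
          rw [map_smul, map_smul, map_smul, wderiv_smul k h1, mulC_smul, smul_add]
        · change -((p.τ⁻¹ : ℝ) : ℂ) • wderiv 1 (Energy.η (k • U))
            = k • (-((p.τ⁻¹ : ℝ) : ℂ) • wderiv 1 U.η)
          rw [map_smul, wderiv_smul k h5, smul_comm] }

section Abstract

variable {X : Type*} [NormedAddCommGroup X] [InnerProductSpace ℂ X]

/-- `A` is dissipative: `Re (A U, U) ≤ 0` for all `U ∈ D(A)`. -/
def IsDissipative (A : X →ₗ.[ℂ] X) : Prop := ∀ U : A.domain, (inner ℂ (U : X) (A U)).re ≤ 0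

/-- `A` is m-dissipative: `A` is dissipative and `μ - A` maps `D(A)` onto the whole space for
every `μ > 0`. -/
def IsMDissipative (A : X →ₗ.[ℂ] X) : Prop :=
  IsDissipative A ∧ ∀ μ : ℝ, 0 < μ → ∀ F : X, ∃ U : A.domain, (μ : ℂ) • (U : X) - A U = F

/-- The resolvent set: the `μ` for which `μ - A : D(A) → X` has an everywhere defined
bounded inverse `R`. -/
def resolventSetOf (A : X →ₗ.[ℂ] X) : Set ℂ :=
  {μ | ∃ R : X →L[ℂ] X,
    (∀ F : X, ∃ h : R F ∈ A.domain, μ • R F - A ⟨R F, h⟩ = F) ∧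
    ∀ U : A.domain, R (μ • (U : X) - A U) = U}

/-- `(T t)`, `t ≥ 0`, is a `C₀`-semigroup of contractions (only the values at `t ≥ 0` matter). -/
structure IsContractionSemigroup (T : ℝ → X →L[ℂ] X) : Prop where
  zero : T 0 = ContinuousLinearMap.id ℂ X
  add : ∀ s t : ℝ, 0 ≤ s → 0 ≤ t → T (s + t) = (T s).comp (T t)
  contraction : ∀ t : ℝ, 0 ≤ t → ‖T t‖ ≤ 1
  continuous_zero : ∀ U : X, Tendsto (fun t => T t U) (𝓝[>] 0) (𝓝 U)

/-- `A` is the infinitesimal generator of `T`: `U ∈ D(A)` and `A U = F` if and only if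
`(T t U - U) / t → F` as `t → 0+`. -/
def IsGeneratorOf (A : X →ₗ.[ℂ] X) (T : ℝ → X →L[ℂ] X) : Prop :=
  ∀ U F : X, (∃ h : U ∈ A.domain, A ⟨U, h⟩ = F) ↔
    Tendsto (fun t : ℝ => ((t⁻¹ : ℝ) : ℂ) • (T t U - U)) (𝓝[>] 0) (𝓝 F)

/-- `U ∈ C⁰([0, ∞), X)` is a weak solution of `U_t = A U`, `U(0) = U₀`: for every `V` in the domain
of the adjoint of `A`, with `G = A* V`, the function `t ↦ (U(t), V)` is differentiable with
derivative `(U(t), G)`. -/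
def IsWeakSolution (A : X →ₗ.[ℂ] X) (U₀ : X) (U : ℝ → X) : Prop :=
  ContinuousOn U (Ici 0) ∧ U 0 = U₀ ∧
  ∀ V G : X, (∀ Y : A.domain, inner ℂ V (A Y) = inner ℂ G (Y : X)) →
    ∀ t : ℝ, 0 ≤ t →
      HasDerivWithinAt (fun s => inner ℂ V (U s)) (inner ℂ G (U t)) (Ici 0) t

/-- `U` is a strong solution of `U_t = A U`, `U(0) = U₀`, of class
`C⁰([0, ∞), D(A)) ∩ C¹([0, ∞), X)`, where `D(A)` carries the graph norm. -/
def IsStrongSolution (A : X →ₗ.[ℂ] X) (U₀ : X) (U : ℝ → X) : Prop :=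
  U 0 = U₀ ∧ ContinuousOn U (Ici 0) ∧
  ∃ G : ℝ → X, ContinuousOn G (Ici 0) ∧ ∀ t : ℝ, 0 ≤ t →
    (∃ h : U t ∈ A.domain, A ⟨U t, h⟩ = G t) ∧ HasDerivWithinAt U (G t) (Ici 0) t

end Abstract

end KelvinVoigt

end

/-!
The operator `A` is dissipative and maps its domain bijectively onto the energy space; everything
else is functional analysis in a Hilbert space.

Dissipativity (`isDissipative_opA`) is the energy balance `re_inner_opA`. It rests on one
integration by parts for weakly differentiable functions with values in a Hilbert space
(`inner_add_inner_of_hasWeakDeriv`), used on `(0, L)` for the two wave equations and on `(0, 1)`,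
with values in `H¹_L(0, β)`, for the transport of the history. The coupling terms cancel, and the
delayed stress is absorbed by the viscous damping since `|κ₂| < κ₁`. Bijectivity (`opA_injective`,
`opA_surjective`) needs no variational argument: the system `A U = F` is triangular and is solved
by taking primitives.

For the abstract part (`wellPosed_of_dissipative_of_bijective`), let `R = A⁻¹`. It is defined
everywhere and dissipative, hence bounded (`continuous_of_dissipative`), and it has dense range
(`denseRange_of_dissipative`), so `D(A)` is dense and `0` lies in the resolvent set. For `ε > 0` the
operator `R - ε` is coercive, hence invertible; with `ε = μ⁻¹` this gives the surjectivity of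
`μ - A`. The inverses `(R - ε)⁻¹` are bounded and dissipative, commute with one another, and
converge strongly to `A` on `D(A)` as `ε → 0`, so their exponentials converge strongly to a
contraction semigroup `T` with `d/dt T(t) R = T(t)` (`exists_solvesInverse`). This identity
identifies the generator and yields the weak and strong solutions.

Uniqueness of weak solutions (`eq_zero_of_weak`) does not use the semigroup: if `D` is the
difference of two weak solutions, its primitive `P` equals `R D`, so that
`d/dt ‖P‖² = 2 Re (R D, D) ≤ 0`.
-/

noncomputable section

namespace KelvinVoigt

section Abstract

variable {X : Type*} [NormedAddCommGroup X] [InnerProductSpace ℂ X]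

/-! ### Dissipative bounded operators -/

theorem inner_self_re_eq (x : X) : (inner ℂ x x).re = ‖x‖ ^ 2 :=
  inner_self_eq_norm_sq (𝕜 := ℂ) x

/-- The energy estimate: a curve whose velocity makes a non-acute angle with its position never
moves away from the origin. It gives the contraction property of exponentials of dissipative
operators and the uniqueness of weak solutions. -/
theorem norm_le_norm_zero_of_dissipative {u u' : ℝ → X}
    (hu : ∀ t, 0 ≤ t → HasDerivWithinAt u (u' t) (Ici 0) t)
    (h : ∀ t, 0 ≤ t → (inner ℂ (u t) (u' t)).re ≤ 0) {t : ℝ} (ht : 0 ≤ t) : ‖u t‖ ≤ ‖u 0‖ := by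
  have hd : ∀ s, 0 ≤ s → HasDerivWithinAt (fun s => (inner ℂ (u s) (u s)).re)
      (inner ℂ (u s) (u' s) + inner ℂ (u' s) (u s)).re (Ici 0) s := fun s hs =>
    Complex.reCLM.hasFDerivAt.comp_hasDerivWithinAt s ((hu s hs).inner ℂ (hu s hs))
  have hanti : AntitoneOn (fun s => (inner ℂ (u s) (u s)).re) (Ici 0) := by
    refine antitoneOn_of_hasDerivWithinAt_nonpos (convex_Ici 0)
      (fun s hs => (hd s hs).continuousWithinAt)
      (fun s hs => (hd s (interior_subset hs)).mono interior_subset) fun s hs => ?_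
    have h1 := h s (interior_subset hs)
    have h2 : (inner ℂ (u' s) (u s)).re = (inner ℂ (u s) (u' s)).re := by
      rw [← inner_conj_symm, Complex.conj_re]
    rw [Complex.add_re, h2]
    linarith
  have h3 : (inner ℂ (u t) (u t)).re ≤ (inner ℂ (u 0) (u 0)).re :=
    hanti (mem_Ici.2 le_rfl) (mem_Ici.2 ht) ht
  rw [inner_self_re_eq, inner_self_re_eq] at h3
  exact abs_le_of_sq_le_sq' h3 (norm_nonneg _) |>.2

/-- A linear operator that stays dissipative after a shift by a constant `g` forces `g = 0`: at the
points `t g` with `t > 0` small, the term `t ‖g‖²` dominates. -/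
theorem eq_zero_of_dissipative_perturbation {R : X →ₗ[ℂ] X} {g : X}
    (h : ∀ x : X, (inner ℂ x (g + R x)).re ≤ 0) : g = 0 := by
  have key : ∀ t : ℝ, 0 < t → ‖g‖ ^ 2 + t * (inner ℂ g (R g)).re ≤ 0 := by
    intro t ht
    have h1 := h ((t : ℂ) • g)
    rw [map_smul, inner_smul_left, inner_add_right, inner_smul_right, Complex.conj_ofReal,
      Complex.re_ofReal_mul, Complex.add_re, Complex.re_ofReal_mul, inner_self_re_eq] at h1
    exact nonpos_of_mul_nonpos_right h1 ht
  have hlim : Tendsto (fun t : ℝ => ‖g‖ ^ 2 + t * (inner ℂ g (R g)).re) (𝓝[>] 0)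
      (𝓝 (‖g‖ ^ 2 + 0 * (inner ℂ g (R g)).re)) :=
    (Continuous.tendsto (by fun_prop) 0).mono_left nhdsWithin_le_nhds
  have h0 := le_of_tendsto hlim (eventually_mem_nhdsWithin.mono key)
  rw [zero_mul, add_zero] at h0
  exact norm_eq_zero.1 (pow_eq_zero_iff two_ne_zero |>.1 (le_antisymm h0 (sq_nonneg _)))

variable [CompleteSpace X]

/-- A dissipative operator that is defined everywhere is bounded, by the closed graph theorem. -/
theorem continuous_of_dissipative (R : X →ₗ[ℂ] X) (hR : ∀ x, (inner ℂ x (R x)).re ≤ 0) :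
    Continuous R := by
  refine R.continuous_of_seq_closed_graph fun u x y hu hy => ?_
  refine sub_eq_zero.1 (eq_zero_of_dissipative_perturbation (R := R) fun h => ?_)
  have h1 : Tendsto (fun n => (inner ℂ (u n - x + h) (R (u n - x + h))).re) atTop
      (𝓝 (inner ℂ (x - x + h) (y - R x + R h)).re) := by
    refine (Complex.continuous_re.tendsto _).comp (Tendsto.inner ?_ ?_)
    · exact (hu.sub_const x).add_const h
    · simp_rw [map_add, map_sub]
      exact (Tendsto.sub_const hy (R x)).add_const (R h)
  rw [sub_self, zero_add] at h1
  exact le_of_tendsto h1 (Eventually.of_forall fun n => hR _)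

/-- An injective dissipative operator has dense range: a vector orthogonal to the range is in the
kernel. -/
theorem denseRange_of_dissipative {R : X →L[ℂ] X} (hR : ∀ x, (inner ℂ x (R x)).re ≤ 0)
    (hinj : Function.Injective R) : DenseRange R := by
  have h0 : (R.range)ᗮ = ⊥ := by
    rw [Submodule.eq_bot_iff]
    intro w hw
    have hw' : ∀ x, inner ℂ w (R x) = 0 := fun x =>
      Submodule.inner_left_of_mem_orthogonal (LinearMap.mem_range_self _ x) hw
    have h1 : R w = 0 := by
      refine eq_zero_of_dissipative_perturbation (R := (R : X →ₗ[ℂ] X)) fun x => ?_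
      have h2 := hR (w + x)
      rwa [inner_add_left, hw', zero_add, map_add] at h2
    exact hinj (h1.trans (map_zero R).symm)
  have h1 := (Submodule.dense_iff_topologicalClosure_eq_top (s := R.range)).2
    ((Submodule.topologicalClosure_eq_top_iff).2 h0)
  rwa [LinearMap.coe_range] at h1

theorem isUnit_sub_smul_one {R : X →L[ℂ] X} (hR : ∀ x, (inner ℂ x (R x)).re ≤ 0) {ε : ℝ}
    (hε : 0 < ε) : IsUnit (R - ε • (1 : X →L[ℂ] X)) := by
  refine ContinuousLinearMap.isUnit_of_forall_le_norm_inner_map _ (c := ⟨ε, hε.le⟩) hε fun x => ?_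
  have h1 : ((inner ℂ ((R - ε • (1 : X →L[ℂ] X)) x) x) : ℂ).re
      = (inner ℂ x (R x)).re - ε * ‖x‖ ^ 2 := by
    rw [← inner_conj_symm, Complex.conj_re]
    simp only [sub_apply, FunLike.coe_smul, Pi.smul_apply,
      one_apply_eq_self, inner_sub_right, Complex.sub_re]
    rw [← Complex.coe_smul, inner_smul_right, Complex.re_ofReal_mul, inner_self_re_eq]
  have h2 := Complex.abs_re_le_norm (inner ℂ ((R - ε • (1 : X →L[ℂ] X)) x) x)
  have h3 := neg_le_abs (inner ℂ ((R - ε • (1 : X →L[ℂ] X)) x) x).re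
  have h4 := hR x
  change ‖x‖ ^ 2 * ε ≤ _
  linarith

theorem hasDerivAt_exp_smul_apply (B : X →L[ℂ] X) (x : X) (t : ℝ) :
    HasDerivAt (fun s : ℝ => NormedSpace.exp (s • B) x) (NormedSpace.exp (t • B) (B x)) t :=
  ((ContinuousLinearMap.apply ℂ X x).restrictScalars ℝ).hasFDerivAt.comp_hasDerivAt t
    (hasDerivAt_exp_smul_const B t)

theorem exp_smul_apply_comm {B C : X →L[ℂ] X} (h : Commute B C) (t : ℝ) (x : X) :
    NormedSpace.exp (t • B) (C x) = C (NormedSpace.exp (t • B) x) :=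
  DFunLike.congr_fun (((h.smul_left t).symm.exp_right).symm).eq x

theorem norm_exp_smul_apply_le {B : X →L[ℂ] X} (hB : ∀ x, (inner ℂ x (B x)).re ≤ 0) {t : ℝ}
    (ht : 0 ≤ t) (x : X) : ‖NormedSpace.exp (t • B) x‖ ≤ ‖x‖ := by
  have h := norm_le_norm_zero_of_dissipative
    (fun s _ => (hasDerivAt_exp_smul_apply B x s).hasDerivWithinAt) (fun s _ => by
      rw [exp_smul_apply_comm (Commute.refl B)]
      exact hB _) ht
  rwa [zero_smul, NormedSpace.exp_zero, one_apply_eq_self] at h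

/-- The semigroups of two commuting bounded dissipative operators differ on `x` by at most `t`
times the difference of the operators on `x`. -/
theorem norm_exp_sub_exp_le {B C : X →L[ℂ] X} (hB : ∀ x, (inner ℂ x (B x)).re ≤ 0)
    (hC : ∀ x, (inner ℂ x (C x)).re ≤ 0) (hBC : Commute B C) {t : ℝ} (ht : 0 ≤ t) (x : X) :
    ‖NormedSpace.exp (t • B) x - NormedSpace.exp (t • C) x‖ ≤ ‖B x - C x‖ * t := by
  -- The curve `s ↦ exp (s B) exp ((t - s) C) x` joins the two vectors.
  have hd : ∀ s : ℝ, HasDerivAt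
      (fun s : ℝ => (NormedSpace.exp (s • B) * NormedSpace.exp ((t - s) • C)) x)
      (NormedSpace.exp (s • B) (NormedSpace.exp ((t - s) • C) (B x - C x))) s := by
    intro s
    have h1 := hasDerivAt_exp_smul_const B s
    have h2 := (hasDerivAt_exp_smul_const C (t - s)).scomp s ((hasDerivAt_id s).const_sub t)
    have h3 := ((ContinuousLinearMap.apply ℂ X x).restrictScalars ℝ).hasFDerivAt.comp_hasDerivAt s
      (h1.mul h2)
    refine h3.congr_deriv ?_
    have e := exp_smul_apply_comm hBC.symm (t - s) x
    simp only [ContinuousLinearMap.coe_restrictScalars', ContinuousLinearMap.apply_apply,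
      add_apply, mul_apply_eq_comp, neg_smul, one_smul,
      Function.comp_apply, map_sub, neg_apply, map_neg, e]
    abel
  have h := norm_image_sub_le_of_norm_deriv_le_segment' (a := 0) (b := t) (C := ‖B x - C x‖)
    (fun s _ => (hd s).hasDerivWithinAt) (fun s hs =>
      (norm_exp_smul_apply_le hB hs.1 _).trans
        (norm_exp_smul_apply_le hC (sub_nonneg.2 hs.2.le) _)) t ⟨ht, le_rfl⟩
  simpa using h

/-! ### The Yosida approximation -/

/-- The Yosida approximation `(R - εₙ)⁻¹`, `εₙ = 1 / (n + 1)`, of the unbounded operator `R⁻¹`. -/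
def yosida (R : X →L[ℂ] X) (n : ℕ) : X →L[ℂ] X :=
  Ring.inverse (R - (1 / ((n : ℝ) + 1)) • (1 : X →L[ℂ] X))

theorem commute_ringInverse_left {M : Type*} [MonoidWithZero M] {a b : M} (h : Commute a b) :
    Commute (Ring.inverse a) b := by
  by_cases ha : IsUnit a
  · obtain ⟨v, rfl⟩ := ha
    rw [Ring.inverse_unit]
    exact h.units_inv_left
  · rw [Ring.inverse_non_unit a ha]
    exact Commute.zero_left b

omit [CompleteSpace X] in
theorem commute_yosida_left (R : X →L[ℂ] X) (n : ℕ) : Commute (yosida R n) R := by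
  have h : Commute (R - (1 / ((n : ℝ) + 1)) • (1 : X →L[ℂ] X)) R :=
    (Commute.refl R).sub_left ((Commute.one_left R).smul_left _)
  exact commute_ringInverse_left h

omit [CompleteSpace X] in
theorem commute_yosida (R : X →L[ℂ] X) (n m : ℕ) : Commute (yosida R n) (yosida R m) :=
  (commute_ringInverse_left
    ((commute_yosida_left R n).sub_right ((Commute.one_right _).smul_right _)).symm).symm

section Yosida

variable {R : X →L[ℂ] X} (hR : ∀ x, (inner ℂ x (R x)).re ≤ 0)

include hR

theorem apply_yosida (n : ℕ) (x : X) :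
    R (yosida R n x) - (1 / ((n : ℝ) + 1)) • yosida R n x = x :=
  DFunLike.congr_fun (Ring.mul_inverse_cancel _ (isUnit_sub_smul_one hR (ε := 1 / ((n : ℝ) + 1))
    (by positivity))) x

theorem yosida_apply (n : ℕ) (x : X) :
    yosida R n (R x) = x + (1 / ((n : ℝ) + 1)) • yosida R n x := by
  have h1 : yosida R n (R x) = R (yosida R n x) :=
    DFunLike.congr_fun (commute_yosida_left R n).eq x
  rw [h1]
  exact sub_eq_iff_eq_add.1 (apply_yosida hR n x)

/-- The basic estimate for `(R - εₙ)⁻¹`: it is the inequality `Re (y, R y) ≤ 0` for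
`y = (R - εₙ)⁻¹ x`. -/
theorem inner_yosida_add_le (n : ℕ) (x : X) :
    (inner ℂ x (yosida R n x)).re + 1 / ((n : ℝ) + 1) * ‖yosida R n x‖ ^ 2 ≤ 0 := by
  have h := hR (yosida R n x)
  have e := sub_eq_iff_eq_add.1 (apply_yosida hR n x)
  rw [e, inner_add_right, Complex.add_re, ← Complex.coe_smul, inner_smul_right,
    Complex.re_ofReal_mul, inner_self_re_eq, ← inner_conj_symm, Complex.conj_re] at h
  exact h

theorem yosida_dissipative (n : ℕ) (x : X) : (inner ℂ x (yosida R n x)).re ≤ 0 := by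
  have h := inner_yosida_add_le hR n x
  have : 0 ≤ 1 / ((n : ℝ) + 1) * ‖yosida R n x‖ ^ 2 := by positivity
  linarith

theorem norm_smul_yosida_le (n : ℕ) (x : X) : ‖(1 / ((n : ℝ) + 1)) • yosida R n x‖ ≤ ‖x‖ := by
  have h := inner_yosida_add_le hR n x
  have h1 := (neg_le_abs _).trans ((Complex.abs_re_le_norm _).trans
    (norm_inner_le_norm (𝕜 := ℂ) x (yosida R n x)))
  rw [norm_smul, Real.norm_of_nonneg (by positivity)]
  rcases (norm_nonneg (yosida R n x)).eq_or_lt with h0 | h0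
  · rw [← h0, mul_zero]; exact norm_nonneg x
  · refine le_of_mul_le_mul_right ?_ h0
    rw [mul_assoc, ← sq]
    linarith

variable (hd : DenseRange R)

include hd

/-- `εₙ (R - εₙ)⁻¹` tends strongly to `0`: this is clear on the range of `R`, and these operators
are contractions. -/
theorem tendsto_smul_yosida (x : X) :
    Tendsto (fun n : ℕ => (1 / ((n : ℝ) + 1)) • yosida R n x) atTop (𝓝 0) := by
  rw [Metric.tendsto_atTop]
  intro ε hε
  obtain ⟨y, hy⟩ := Metric.denseRange_iff.1 hd x (ε / 2) (half_pos hε)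
  have h0 : Tendsto (fun n : ℕ => 1 / ((n : ℝ) + 1) * (2 * ‖y‖)) atTop (𝓝 (0 * (2 * ‖y‖))) :=
    tendsto_one_div_add_atTop_nhds_zero_nat.mul_const _
  rw [zero_mul] at h0
  obtain ⟨N, hN⟩ := Metric.tendsto_atTop.1 h0 (ε / 2) (half_pos hε)
  refine ⟨N, fun n hn => ?_⟩
  have h1 := norm_smul_yosida_le hR n (x - R y)
  have h2 := norm_smul_yosida_le hR n y
  have h3 := hN n hn
  have hp : 0 < 1 / ((n : ℝ) + 1) := by positivity
  rw [Real.dist_eq, sub_zero] at h3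
  have h4 := (le_abs_self _).trans_lt h3
  have h5 : ‖(1 / ((n : ℝ) + 1)) • yosida R n (R y)‖ ≤ 1 / ((n : ℝ) + 1) * (2 * ‖y‖) := by
    rw [yosida_apply hR, norm_smul, Real.norm_of_nonneg hp.le]
    refine mul_le_mul_of_nonneg_left ((norm_add_le _ _).trans ?_) hp.le
    linarith
  rw [dist_eq_norm] at hy
  rw [dist_zero_right]
  have h6 : (1 / ((n : ℝ) + 1)) • yosida R n x = (1 / ((n : ℝ) + 1)) • yosida R n (x - R y)
      + (1 / ((n : ℝ) + 1)) • yosida R n (R y) := by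
    rw [← smul_add, ← map_add, sub_add_cancel]
  rw [h6]
  refine (norm_add_le _ _).trans_lt ?_
  linarith

theorem tendsto_yosida_apply (x : X) :
    Tendsto (fun n : ℕ => yosida R n (R x)) atTop (𝓝 x) := by
  simp_rw [yosida_apply hR]
  simpa using (tendsto_smul_yosida hR hd x).const_add x

theorem cauchySeq_exp_yosida {t : ℝ} (ht : 0 ≤ t) (x : X) :
    CauchySeq fun n : ℕ => NormedSpace.exp (t • yosida R n) x := by
  rw [Metric.cauchySeq_iff]
  intro ε hε
  obtain ⟨y, hy⟩ := Metric.denseRange_iff.1 hd x (ε / 3) (by positivity)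
  obtain ⟨N, hN⟩ := Metric.cauchySeq_iff.1 (tendsto_yosida_apply hR hd y).cauchySeq
    (ε / (3 * (t + 1))) (by positivity)
  refine ⟨N, fun n hn m hm => ?_⟩
  have h1 := norm_exp_smul_apply_le (yosida_dissipative hR n) ht (x - R y)
  have h2 := norm_exp_smul_apply_le (yosida_dissipative hR m) ht (x - R y)
  have h3 := norm_exp_sub_exp_le (yosida_dissipative hR n) (yosida_dissipative hR m)
    (commute_yosida R n m) ht (R y)
  have h4 := hN n hn m hm
  rw [dist_eq_norm] at h4 hy ⊢
  have h5 : ‖yosida R n (R y) - yosida R m (R y)‖ * t ≤ ε / 3 := by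
    have h6 : ε / (3 * (t + 1)) * t ≤ ε / 3 := by
      rw [div_mul_eq_mul_div, div_le_div_iff₀ (by positivity) (by positivity)]
      nlinarith
    exact (mul_le_mul_of_nonneg_right h4.le ht).trans h6
  have h7 : NormedSpace.exp (t • yosida R n) x - NormedSpace.exp (t • yosida R m) x
      = NormedSpace.exp (t • yosida R n) (x - R y) + (NormedSpace.exp (t • yosida R n) (R y)
        - NormedSpace.exp (t • yosida R m) (R y)) - NormedSpace.exp (t • yosida R m) (x - R y) := by
    rw [map_sub, map_sub]; abel
  rw [h7]
  refine (norm_sub_le _ _).trans_lt (lt_of_le_of_lt (add_le_add_left (norm_add_le _ _) _) ?_)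
  linarith

/-- The strong limit of the semigroups of the Yosida approximations; it is frozen at its initial
value for negative times, so that it is continuous on the whole line. -/
theorem exists_tendsto_exp_yosida : ∃ T : ℝ → X →L[ℂ] X, ∀ t x,
    Tendsto (fun n : ℕ => NormedSpace.exp (max t 0 • yosida R n) x) atTop (𝓝 (T t x)) := by
  have h : ∀ t : ℝ, ∃ S : X →L[ℂ] X, ∀ x,
      Tendsto (fun n : ℕ => NormedSpace.exp (max t 0 • yosida R n) x) atTop (𝓝 (S x)) := by
    intro t
    choose f hf using fun x => cauchySeq_tendsto_of_complete
      (cauchySeq_exp_yosida hR hd (le_max_right t 0) x)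
    exact ⟨continuousLinearMapOfTendsto (fun n : ℕ => NormedSpace.exp (max t 0 • yosida R n))
      (tendsto_pi_nhds.2 hf), hf⟩
  choose T hT using h
  exact ⟨T, hT⟩

end Yosida

/-! ### The semigroup generated by the inverse of a bounded dissipative operator -/

/-- `T` is a contraction semigroup which commutes with `R` and satisfies `d/dt T(t) R = T(t)`, so
that it solves `U_t = R⁻¹ U`. The semigroup law and the derivative concern `t ≥ 0` only; continuity
and contractivity are asked for all real `t`, which costs nothing since `T` may be taken constant
for `t ≤ 0`, and makes `∫ T(s) x ds` the integral of a continuous function. -/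
structure SolvesInverse (R : X →L[ℂ] X) (T : ℝ → X →L[ℂ] X) : Prop where
  zero : T 0 = ContinuousLinearMap.id ℂ X
  add : ∀ s t : ℝ, 0 ≤ s → 0 ≤ t → T (s + t) = (T s).comp (T t)
  contraction : ∀ t x, ‖T t x‖ ≤ ‖x‖
  continuous : ∀ x, Continuous fun t => T t x
  comm : ∀ t x, T t (R x) = R (T t x)
  hasDeriv : ∀ x t, 0 ≤ t → HasDerivWithinAt (fun s => T s (R x)) (T t x) (Ici 0) t

theorem exists_solvesInverse {R : X →L[ℂ] X} (hR : ∀ x, (inner ℂ x (R x)).re ≤ 0)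
    (hd : DenseRange R) : ∃ T : ℝ → X →L[ℂ] X, SolvesInverse R T := by
  obtain ⟨T, hT⟩ := exists_tendsto_exp_yosida hR hd
  have hT' : ∀ t x, 0 ≤ t →
      Tendsto (fun n : ℕ => NormedSpace.exp (t • yosida R n) x) atTop (𝓝 (T t x)) := by
    intro t x ht
    have h := hT t x
    rwa [max_eq_left ht] at h
  have hle : ∀ (n : ℕ) (t : ℝ) (x : X), 0 ≤ t → ‖NormedSpace.exp (t • yosida R n) x‖ ≤ ‖x‖ :=
    fun n t x ht => norm_exp_smul_apply_le (yosida_dissipative hR n) ht x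
  have hcontr : ∀ t x, ‖T t x‖ ≤ ‖x‖ := fun t x =>
    le_of_tendsto (hT t x).norm (Eventually.of_forall fun n => hle n _ x (le_max_right _ _))
  have hneg : ∀ t x, T (max t 0) x = T t x := fun t x => by
    have h := hT (max t 0) x
    rw [max_eq_left (le_max_right t 0)] at h
    exact tendsto_nhds_unique h (hT t x)
  have hyle : ∀ (n : ℕ) (y : X), ‖yosida R n (R y)‖ ≤ 2 * ‖y‖ := by
    intro n y
    rw [yosida_apply hR]
    exact (norm_add_le _ _).trans (by linarith [norm_smul_yosida_le hR n y])
  have hint : ∀ (n : ℕ) (y : X) (s t : ℝ),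
      ∫ r in s..t, NormedSpace.exp (r • yosida R n) (yosida R n (R y))
        = NormedSpace.exp (t • yosida R n) (R y) - NormedSpace.exp (s • yosida R n) (R y) := by
    intro n y s t
    refine intervalIntegral.integral_eq_sub_of_hasDerivAt
      (fun r _ => hasDerivAt_exp_smul_apply (yosida R n) (R y) r) (Continuous.intervalIntegrable ?_ _ _)
    exact continuous_iff_continuousAt.2 fun r =>
      (hasDerivAt_exp_smul_apply (yosida R n) (yosida R n (R y)) r).continuousAt
  -- On the range of `R` the approximating semigroups are Lipschitz with a common constant.
  have hlip : ∀ (y : X) (s t : ℝ), 0 ≤ s → 0 ≤ t →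
      ‖T t (R y) - T s (R y)‖ ≤ 2 * ‖y‖ * |t - s| := by
    intro y s t hs ht
    refine le_of_tendsto ((hT' t (R y) ht).sub (hT' s (R y) hs)).norm
      (Eventually.of_forall fun n => ?_)
    rw [← hint n y s t]
    refine intervalIntegral.norm_integral_le_of_norm_le_const fun r hr => ?_
    exact (hle n r _ ((le_min hs ht).trans hr.1.le)).trans (hyle n y)
  have hcontR : ∀ y, Continuous fun t => T t (R y) := by
    intro y
    have h : LipschitzWith (2 * ‖y‖₊) fun t => T (max t 0) (R y) := by
      refine LipschitzWith.of_dist_le_mul fun t s => ?_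
      rw [dist_eq_norm, Real.dist_eq]
      refine (hlip y _ _ (le_max_right _ _) (le_max_right _ _)).trans ?_
      refine mul_le_mul_of_nonneg_left ?_ (by positivity)
      exact abs_max_sub_max_le_abs t s 0
    simpa only [hneg] using h.continuous
  have hcont : ∀ x, Continuous fun t => T t x := by
    intro x
    refine continuous_of_uniform_approx_of_continuous fun V hV => ?_
    obtain ⟨ε, hε, hV'⟩ := Metric.mem_uniformity_dist.1 hV
    obtain ⟨y, hy⟩ := Metric.denseRange_iff.1 hd x ε hε
    refine ⟨fun t => T t (R y), hcontR y, fun t => hV' ?_⟩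
    rw [dist_eq_norm, ← map_sub]
    rw [dist_eq_norm] at hy
    exact (hcontr t _).trans_lt hy
  have hFTC : ∀ (y : X) (t : ℝ), 0 ≤ t → ∫ r in (0 : ℝ)..t, T r y = T t (R y) - T 0 (R y) := by
    intro y t ht
    have h1 : Tendsto (fun n : ℕ => ∫ r in (0 : ℝ)..t,
        NormedSpace.exp (r • yosida R n) (yosida R n (R y))) atTop
        (𝓝 (∫ r in (0 : ℝ)..t, T r y)) := by
      refine intervalIntegral.tendsto_integral_filter_of_dominated_convergence
        (fun _ => 2 * ‖y‖) ?_ ?_ intervalIntegrable_const ?_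
      · exact Eventually.of_forall fun n => Continuous.aestronglyMeasurable
          (continuous_iff_continuousAt.2 fun r =>
            (hasDerivAt_exp_smul_apply (yosida R n) (yosida R n (R y)) r).continuousAt)
      · refine Eventually.of_forall fun n => Eventually.of_forall fun r hr => ?_
        rw [uIoc_of_le ht] at hr
        exact (hle n r _ hr.1.le).trans (hyle n y)
      · refine Eventually.of_forall fun r hr => ?_
        rw [uIoc_of_le ht] at hr
        have h2 : Tendsto (fun n : ℕ => NormedSpace.exp (r • yosida R n) (yosida R n (R y) - y))
            atTop (𝓝 0) := by
          refine squeeze_zero_norm (fun n => hle n r _ hr.1.le) ?_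
          simpa using ((tendsto_yosida_apply hR hd y).sub_const y).norm
        have h3 := h2.add (hT' r y hr.1.le)
        simpa only [map_sub, sub_add_cancel, zero_add] using h3
    simp_rw [hint] at h1
    exact tendsto_nhds_unique h1 ((hT' t (R y) ht).sub (hT' 0 (R y) le_rfl))
  refine ⟨T, ?_, ?_, hcontr, hcont, ?_, ?_⟩
  · ext x
    refine tendsto_nhds_unique (hT' 0 x le_rfl) ?_
    simp only [zero_smul, NormedSpace.exp_zero, one_apply_eq_self]
    exact tendsto_const_nhds
  · intro s t hs ht
    ext x
    -- Contractivity allows passing to the limit in both factors of the semigroup law at once.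
    have h1 : Tendsto (fun n : ℕ => NormedSpace.exp (s • yosida R n)
        (NormedSpace.exp (t • yosida R n) x - T t x)) atTop (𝓝 0) := by
      refine squeeze_zero_norm (fun n => hle n s _ hs) ?_
      simpa using ((hT' t x ht).sub_const (T t x)).norm
    have h2 := h1.add (hT' s (T t x) hs)
    simp only [map_sub, sub_add_cancel, zero_add] at h2
    refine tendsto_nhds_unique (hT' (s + t) x (add_nonneg hs ht)) (h2.congr fun n => ?_)
    let _ : NormedAlgebra ℚ (X →L[ℂ] X) := NormedAlgebra.restrictScalars ℚ ℝ _
    rw [add_smul, NormedSpace.exp_add_of_commute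
      (((Commute.refl (yosida R n)).smul_left s).smul_right t)]
    rfl
  · intro t x
    refine tendsto_nhds_unique (hT t (R x)) ?_
    have h := (R.continuous.tendsto (T t x)).comp (hT t x)
    exact h.congr fun n => (exp_smul_apply_comm (commute_yosida_left R n) _ x).symm
  · intro y t ht
    have h1 := ((hcont y).integral_hasStrictDerivAt 0 t).hasDerivAt.hasDerivWithinAt (s := Ici 0)
    refine (h1.add_const (T 0 (R y))).congr (fun s hs => ?_) ?_
    · rw [hFTC y s hs, sub_add_cancel]
    · rw [hFTC y t ht, sub_add_cancel]

namespace SolvesInverse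

variable {R : X →L[ℂ] X} {T : ℝ → X →L[ℂ] X} (hT : SolvesInverse R T)

include hT

omit [CompleteSpace X] in
theorem isContractionSemigroup : IsContractionSemigroup T where
  zero := hT.zero
  add := hT.add
  contraction t _ := ContinuousLinearMap.opNorm_le_bound _ zero_le_one fun x => by
    rw [one_mul]; exact hT.contraction t x
  continuous_zero x := by
    have h := (hT.continuous x).tendsto 0
    rw [hT.zero, ContinuousLinearMap.id_apply] at h
    exact h.mono_left nhdsWithin_le_nhds

omit [CompleteSpace X] in
theorem tendsto_diffQuot (x : X) :
    Tendsto (fun t : ℝ => ((t⁻¹ : ℝ) : ℂ) • (T t (R x) - R x)) (𝓝[>] 0) (𝓝 x) := by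
  have h := (hasDerivWithinAt_iff_tendsto_slope' (by simp)).1
    ((hT.hasDeriv x 0 le_rfl).mono Ioi_subset_Ici_self)
  simp only [hT.zero, ContinuousLinearMap.id_apply] at h
  refine h.congr fun t => ?_
  rw [slope_def_module, sub_zero, Complex.coe_smul, hT.zero, ContinuousLinearMap.id_apply]

end SolvesInverse

/-- Uniqueness for the weak Cauchy problem of `R⁻¹`, whose adjoint has the domain
`{R* G}`. The primitive `P` of a weak solution `D` with `D(0) = 0` equals `R D`, so that
`d/dt ‖P‖² = 2 Re (R D, D) ≤ 0`, and `P = 0`. -/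
theorem eq_zero_of_weak {R : X →L[ℂ] X} (hR : ∀ x, (inner ℂ x (R x)).re ≤ 0)
    (hinj : Function.Injective R) {D : ℝ → X} (hc : ContinuousOn D (Ici 0)) (h0 : D 0 = 0)
    (hw : ∀ V G : X, (∀ y, inner ℂ V y = inner ℂ G (R y)) → ∀ t : ℝ, 0 ≤ t →
      HasDerivWithinAt (fun s => inner ℂ V (D s)) (inner ℂ G (D t)) (Ici 0) t) :
    ∀ t, 0 ≤ t → D t = 0 := by
  -- A continuous extension of `D` to the whole line, for the fundamental theorem of calculus.
  set D' : ℝ → X := fun t => D (max t 0) with hD'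
  have hc' : Continuous D' := hc.comp_continuous (by fun_prop) fun t => le_max_right t 0
  have hDD : ∀ t, 0 ≤ t → D' t = D t := fun t ht => by rw [hD']; simp only [max_eq_left ht]
  set P : ℝ → X := fun t => ∫ s in (0 : ℝ)..t, D' s with hP
  have hPd : ∀ t, 0 ≤ t → HasDerivWithinAt P (D t) (Ici 0) t := fun t ht => by
    rw [← hDD t ht]
    exact (hc'.integral_hasStrictDerivAt 0 t).hasDerivAt.hasDerivWithinAt
  have hP0 : P 0 = 0 := intervalIntegral.integral_same
  have hPR : ∀ t, 0 ≤ t → P t = R (D t) := by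
    intro t ht
    refine ext_inner_left ℂ fun G => ?_
    have hd : ∀ s, 0 ≤ s → HasDerivWithinAt
        (fun s => inner ℂ (R.adjoint G) (D s) - inner ℂ G (P s)) 0 (Ici 0) s := by
      intro s hs
      have h1 := hw (R.adjoint G) G (fun y => R.adjoint_inner_left y G) s hs
      have h2 := (hasDerivWithinAt_const s (Ici 0) G).inner ℂ (hPd s hs)
      rw [inner_zero_left, add_zero] at h2
      simpa only [sub_self] using! h1.sub h2
    have h3 := constant_of_has_deriv_right_zero (a := 0) (b := t)
      (fun s hs => (hd s hs.1).continuousWithinAt.mono Icc_subset_Ici_self)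
      (fun s hs => (hd s hs.1).mono (Ici_subset_Ici.2 hs.1)) t ⟨ht, le_rfl⟩
    simp only [h0, hP0, inner_zero_right, map_zero, sub_zero, R.adjoint_inner_left] at h3
    exact (sub_eq_zero.1 h3).symm
  intro t ht
  have h1 := norm_le_norm_zero_of_dissipative hPd (fun s hs => by
    rw [hPR s hs, ← inner_conj_symm, Complex.conj_re]
    exact hR _) ht
  rw [hP0, norm_zero, norm_le_zero_iff, hPR t ht] at h1
  exact hinj (h1.trans (map_zero R).symm)

/-! ### Dissipative bijections -/

/-- The functional-analytic content of the theorem: a dissipative operator that maps its domain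
bijectively onto the space is m-dissipative, densely defined, has `0` in its resolvent set, and
generates a contraction semigroup, which solves the Cauchy problem. -/
theorem wellPosed_of_dissipative_of_bijective (A : X →ₗ.[ℂ] X) (hA : IsDissipative A)
    (hinj : ∀ U : A.domain, A U = 0 → U = 0) (hsurj : ∀ F : X, ∃ U : A.domain, A U = F) :
    IsMDissipative A ∧ Dense (A.domain : Set X) ∧ (0 : ℂ) ∈ resolventSetOf A ∧
    ∃ T : ℝ → X →L[ℂ] X, IsContractionSemigroup T ∧ IsGeneratorOf A T ∧
      (∀ U₀ : X, IsWeakSolution A U₀ (fun t => T t U₀) ∧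
        ∀ U : ℝ → X, IsWeakSolution A U₀ U → EqOn U (fun t => T t U₀) (Ici 0)) ∧
      (∀ U₀ ∈ A.domain, IsStrongSolution A U₀ (fun t => T t U₀) ∧
        ∀ U : ℝ → X, IsStrongSolution A U₀ U → EqOn U (fun t => T t U₀) (Ici 0)) := by
  let e : A.domain ≃ₗ[ℂ] X := LinearEquiv.ofBijective A.toFun
    ⟨(injective_iff_map_eq_zero A.toFun).2 hinj, hsurj⟩
  have heA : ∀ U, e U = A U := fun _ => rfl
  have hdiss : ∀ F : X, (inner ℂ F (e.symm F : X)).re ≤ 0 := by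
    intro F
    have h := hA (e.symm F)
    rw [← heA, e.apply_symm_apply] at h
    rwa [← inner_conj_symm, Complex.conj_re]
  let R₀ : X →ₗ[ℂ] X := A.domain.subtype ∘ₗ e.symm.toLinearMap
  let R : X →L[ℂ] X := ⟨R₀, continuous_of_dissipative R₀ hdiss⟩
  have hR : ∀ x, (inner ℂ x (R x)).re ≤ 0 := hdiss
  have hRmem : ∀ F, R F ∈ A.domain := fun F => (e.symm F).2
  have hAR : ∀ F (h : R F ∈ A.domain), A ⟨R F, h⟩ = F := fun F _ => e.apply_symm_apply F
  have hRA : ∀ U : A.domain, R (A U) = U := fun U => congrArg Subtype.val (e.symm_apply_apply U)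
  have hRinj : Function.Injective R := Subtype.val_injective.comp e.symm.injective
  have hdense := denseRange_of_dissipative hR hRinj
  obtain ⟨T, hT⟩ := exists_solvesInverse hR hdense
  have hcont : ∀ x s, ContinuousOn (fun t => T t x) s := fun x s => (hT.continuous x).continuousOn
  have hT0 : ∀ x, T 0 x = x := fun x => by rw [hT.zero, ContinuousLinearMap.id_apply]
  have hweak : ∀ U₀, IsWeakSolution A U₀ (fun t => T t U₀) := by
    refine fun U₀ => ⟨hcont U₀ _, hT0 U₀, fun V G hVG t ht => ?_⟩
    have hVG' : ∀ y, inner ℂ V y = inner ℂ G (R y) := fun y => by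
      have h := hVG ⟨R y, hRmem y⟩
      rwa [hAR] at h
    have h := (hasDerivWithinAt_const t (Ici 0) G).inner ℂ (hT.hasDeriv U₀ t ht)
    rw [inner_zero_left, add_zero] at h
    simpa only [hVG', ← hT.comm] using h
  have huniq : ∀ U₀ U, IsWeakSolution A U₀ U → EqOn U (fun t => T t U₀) (Ici 0) := by
    rintro U₀ U ⟨hc, h0, hw⟩ t ht
    refine sub_eq_zero.1 (eq_zero_of_weak hR hRinj (D := fun t => U t - T t U₀)
      (hc.sub (hcont U₀ _)) ?_ (fun V G hVG s hs => ?_) t ht)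
    · simp only [h0, hT0, sub_self]
    · have hVG' : ∀ Y : A.domain, inner ℂ V (A Y) = inner ℂ G (Y : X) := fun Y => by
        rw [hVG, hRA]
      simpa only [inner_sub_right] using! (hw V G hVG' s hs).sub ((hweak U₀).2.2 V G hVG' s hs)
  refine ⟨⟨hA, fun μ hμ F => ?_⟩, ?_, ?_, T, hT.isContractionSemigroup, ?_,
    fun U₀ => ⟨hweak U₀, huniq U₀⟩, fun U₀ hU₀ => ⟨?_, ?_⟩⟩
  · -- With `U = R G`, the equation `μ U - A U = F` reads `(R - μ⁻¹) G = μ⁻¹ F`.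
    obtain ⟨S, hS⟩ := isUnit_sub_smul_one hR (inv_pos.2 hμ)
    have h1 : (R - μ⁻¹ • (1 : X →L[ℂ] X)) ((↑S⁻¹ : X →L[ℂ] X) (μ⁻¹ • F)) = μ⁻¹ • F := by
      rw [← hS]
      exact DFunLike.congr_fun S.mul_inv (μ⁻¹ • F)
    refine ⟨⟨R _, hRmem ((↑S⁻¹ : X →L[ℂ] X) (μ⁻¹ • F))⟩, ?_⟩
    rw [hAR]
    have h2 := congrArg (fun x => μ • x) h1
    simp only [sub_apply, smul_apply,
      one_apply_eq_self, smul_sub, smul_inv_smul₀ hμ.ne'] at h2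
    rw [Complex.coe_smul]
    exact h2
  · refine hdense.mono ?_
    rintro _ ⟨F, rfl⟩
    exact hRmem F
  · refine ⟨-R, fun F => ⟨A.domain.neg_mem (hRmem F), ?_⟩, fun U => ?_⟩
    · have h : (⟨(-R) F, A.domain.neg_mem (hRmem F)⟩ : A.domain) = -⟨R F, hRmem F⟩ := rfl
      rw [zero_smul, zero_sub, h, LinearPMap.map_neg, neg_neg, hAR]
    · rw [zero_smul, zero_sub, map_neg, neg_apply, neg_neg, hRA]
  · intro U F
    constructor
    · rintro ⟨h, rfl⟩
      have h1 := hT.tendsto_diffQuot (A ⟨U, h⟩)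
      rwa [hRA] at h1
    · intro h
      have h1 := (R.continuous.tendsto F).comp h
      -- Both sides are limits of `R ((T(t) U - U) / t)`.
      have h2 : U = R F := by
        refine tendsto_nhds_unique ((hT.tendsto_diffQuot U).congr fun t => ?_) h1
        rw [Function.comp_apply, map_smul, map_sub, hT.comm]
      subst h2
      exact ⟨hRmem F, hAR F _⟩
  · refine ⟨hT0 U₀, hcont U₀ _, fun t => T t (A ⟨U₀, hU₀⟩), hcont _ _, fun t ht => ?_⟩
    have h1 : R (A ⟨U₀, hU₀⟩) = U₀ := hRA ⟨U₀, hU₀⟩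
    have h2 : T t U₀ = R (T t (A ⟨U₀, hU₀⟩)) := by rw [← hT.comm, h1]
    refine ⟨?_, ?_⟩
    · simp only [h2]
      exact ⟨hRmem _, hAR _ _⟩
    · have h3 := hT.hasDeriv (A ⟨U₀, hU₀⟩) t ht
      rwa [h1] at h3
  · rintro U ⟨h0, hc, G', -, hU⟩
    refine huniq U₀ U ⟨hc, h0, fun V G hVG t ht => ?_⟩
    obtain ⟨⟨h1, h2⟩, h3⟩ := hU t ht
    have h4 := (hasDerivWithinAt_const t (Ici 0) V).inner ℂ h3
    rw [inner_zero_left, add_zero, ← h2, hVG] at h4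
    exact h4

end Abstract

/-! ### Integration by parts for weakly differentiable functions -/

section Parts

variable {E : Type*} [NormedAddCommGroup E] [InnerProductSpace ℂ E] {ℓ : ℝ}

theorem prim_eq_setIntegral_Iic (w : L2 ℓ E) {x : ℝ} (hx : 0 ≤ x) :
    prim ℓ w x = ∫ t in Iic x, w t ∂(vol ℓ) := by
  have h : Ioc 0 x ∩ Ioo 0 ℓ = Iic x ∩ Ioo 0 ℓ := by
    ext t
    exact ⟨fun h => ⟨h.1.2, h.2⟩, fun h => ⟨⟨h.2.1, h.1⟩, h.2⟩⟩
  rw [prim, intervalIntegral.integral_of_le hx, setIntegral_indicator measurableSet_Ioo, h,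
    Measure.restrict_restrict measurableSet_Iic]

theorem prim_eq_setIntegral_Iio (w : L2 ℓ E) {x : ℝ} (hx : 0 ≤ x) :
    prim ℓ w x = ∫ t in Iio x, w t ∂(vol ℓ) := by
  rw [prim_eq_setIntegral_Iic w hx]
  exact setIntegral_congr_set Iio_ae_eq_Iic.symm

theorem prim_right (hℓ : 0 < ℓ) (w : L2 ℓ E) : prim ℓ w ℓ = ∫ t, w t ∂(vol ℓ) := by
  rw [prim_eq_setIntegral_Iic w hℓ.le, Measure.restrict_restrict measurableSet_Iic,
    inter_eq_right.2 fun t ht => ht.2.le]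

variable [CompleteSpace E]

/-- Integration by parts for primitives. Both sides are integrals of `(w(t), w'(x))` over the
square; the two terms on the left are the integrals over the triangles `t < x` and `x ≤ t`. -/
theorem inner_primL_add_inner_primL (hℓ : 0 < ℓ) (w w' : L2 ℓ E) :
    inner ℂ (primL ℓ w) w' + inner ℂ w (primL ℓ w') = inner ℂ (prim ℓ w ℓ) (prim ℓ w' ℓ) := by
  set K : ℝ × ℝ → ℂ := fun q => inner ℂ (w q.2) (w' q.1) with hK
  set S : Set (ℝ × ℝ) := {q | q.2 < q.1} with hS
  have hSm : MeasurableSet S := measurableSet_lt measurable_snd measurable_fst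
  have hi : Integrable K ((vol ℓ).prod (vol ℓ)) := by
    refine ((integrable_L2 w').norm.mul_prod (integrable_L2 w).norm).mono
      ((integrable_L2 w).1.comp_snd.inner (integrable_L2 w').1.comp_fst)
      (Eventually.of_forall fun q => ?_)
    rw [norm_mul, norm_norm, norm_norm, mul_comm]
    exact norm_inner_le_norm _ _
  have inner_left : ∀ (f : ℝ → E) (s : Set ℝ) (e : E), IntegrableOn f s (vol ℓ) →
      inner ℂ (∫ t in s, f t ∂(vol ℓ)) e = ∫ t in s, inner ℂ (f t) e ∂(vol ℓ) := by
    intro f s e hf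
    rw [← inner_conj_symm, ← integral_inner hf, ← integral_conj]
    simp_rw [inner_conj_symm]
  have e1 : inner ℂ (primL ℓ w) w' = ∫ q, S.indicator K q ∂((vol ℓ).prod (vol ℓ)) := by
    rw [L2.inner_def, integral_prod _ (hi.indicator hSm)]
    apply integral_congr_ae
    filter_upwards [primL_ae w, ae_restrict_mem measurableSet_Ioo] with x hx hx0
    rw [hx, prim_eq_setIntegral_Iio w hx0.1.le, inner_left _ _ _ (integrable_L2 w).integrableOn,
      ← integral_indicator measurableSet_Iio]
    rfl
  have e2 : inner ℂ w (primL ℓ w') = ∫ q, Sᶜ.indicator K q ∂((vol ℓ).prod (vol ℓ)) := by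
    rw [L2.inner_def, integral_prod_symm _ (hi.indicator hSm.compl)]
    apply integral_congr_ae
    filter_upwards [primL_ae w', ae_restrict_mem measurableSet_Ioo] with t ht ht0
    rw [ht, prim_eq_setIntegral_Iic w' ht0.1.le, ← integral_inner (integrable_L2 w').integrableOn,
      ← integral_indicator measurableSet_Iic]
    refine integral_congr_ae (Eventually.of_forall fun x => ?_)
    by_cases h : x ≤ t
    · have h' : (x, t) ∈ Sᶜ := not_lt.2 h
      simp only [indicator_of_mem h', indicator_of_mem (mem_Iic.2 h), hK]
    · have h' : (x, t) ∉ Sᶜ := fun hh => h (not_lt.1 hh)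
      simp only [indicator_of_notMem h', indicator_of_notMem (fun hh => h (mem_Iic.1 hh))]
  rw [e1, e2, integral_indicator hSm, integral_indicator hSm.compl, integral_add_compl hSm hi,
    integral_prod _ hi, prim_right hℓ, prim_right hℓ, ← integral_inner (integrable_L2 w')]
  refine integral_congr_ae (Eventually.of_forall fun x => ?_)
  have h := inner_left w univ (w' x) (integrable_L2 w).integrableOn
  simp only [Measure.restrict_univ] at h
  exact h.symm

theorem inner_const_left (hℓ : 0 < ℓ) (c : E) (w : L2 ℓ E) :
    inner ℂ (Lp.const 2 (vol ℓ) c) w = inner ℂ c (prim ℓ w ℓ) := by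
  rw [L2.inner_def, prim_right hℓ, ← integral_inner (integrable_L2 w)]
  apply integral_congr_ae
  filter_upwards [Lp.coeFn_const 2 (vol ℓ) c] with x hx
  rw [hx, Function.const_apply]

theorem prim_const (hℓ : 0 < ℓ) (c : E) : prim ℓ (Lp.const 2 (vol ℓ) c) ℓ = (ℓ : ℂ) • c := by
  rw [prim_right hℓ, integral_congr_ae (Lp.coeFn_const 2 (vol ℓ) c)]
  simp only [Function.const_apply, integral_const, vol, measureReal_restrict_apply_univ,
    Real.volume_real_Ioo_of_le hℓ.le, sub_zero, Complex.coe_smul]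

theorem hasWeakDeriv_const (c : E) : HasWeakDeriv ℓ (Lp.const 2 (vol ℓ) c) 0 := by
  intro φ hφ
  have e0 : ∫ x, φ x • (0 : L2 ℓ E) x ∂(vol ℓ) = 0 := by
    apply integral_eq_zero_of_ae
    filter_upwards [Lp.coeFn_zero E 2 (vol ℓ)] with x hx
    rw [hx, Pi.zero_apply, smul_zero]
  have e1 : ∫ x, deriv φ x • (Lp.const 2 (vol ℓ) c : L2 ℓ E) x ∂(vol ℓ)
      = ∫ x, deriv φ x • c ∂(vol ℓ) := by
    apply integral_congr_ae
    filter_upwards [Lp.coeFn_const 2 (vol ℓ) c] with x hx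
    rw [hx, Function.const_apply]
  rw [e0, e1, neg_zero, integral_smul_const]
  have e2 : ∫ x, deriv φ x ∂(vol ℓ) = 0 := by
    rcases le_or_gt ℓ 0 with hℓ | hℓ
    · rw [vol, Ioo_eq_empty (not_lt.2 hℓ), Measure.restrict_empty, integral_zero_measure]
    · rw [vol, ← integral_Ioc_eq_integral_Ioo, ← intervalIntegral.integral_of_le hℓ.le,
        intervalIntegral.integral_deriv_eq_sub
          (fun x _ => (hφ.1.differentiable (by simp)).differentiableAt)
          (hφ.deriv_cont.1.intervalIntegrable _ _), hφ.zero (by simp), hφ.zero (by simp), sub_zero]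
  rw [e2, zero_smul]

theorem hasTrace_const_add_primL (c : E) (w : L2 ℓ E) (x : ℝ) :
    HasTrace ℓ (Lp.const 2 (vol ℓ) c + primL ℓ w) x (c + prim ℓ w x) := by
  refine ⟨fun x => c + prim ℓ w x, (continuous_const.add (continuous_prim w)).continuousOn, ?_, rfl⟩
  filter_upwards [Lp.coeFn_add (Lp.const 2 (vol ℓ) c) (primL ℓ w), Lp.coeFn_const 2 (vol ℓ) c,
    primL_ae w] with y h1 h2 h3
  rw [h1, Pi.add_apply, h2, h3, Function.const_apply]

theorem hasWeakDeriv_const_add_primL (c : E) (w : L2 ℓ E) :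
    HasWeakDeriv ℓ (Lp.const 2 (vol ℓ) c + primL ℓ w) w := by
  simpa only [zero_add] using (hasWeakDeriv_const c).add (hasWeakDeriv_primL ℓ w)

theorem HasWeakDeriv.eq_const_add_primL (hℓ : 0 < ℓ) {u w : L2 ℓ E} (h : HasWeakDeriv ℓ u w)
    {e : E} (h0 : HasTrace ℓ u 0 e) : u = Lp.const 2 (vol ℓ) e + primL ℓ w := by
  obtain ⟨c, hc⟩ := h.ae_eq_prim hℓ
  have hu : u = Lp.const 2 (vol ℓ) c + primL ℓ w := by
    apply Lp.ext
    filter_upwards [hc, Lp.coeFn_add (Lp.const 2 (vol ℓ) c) (primL ℓ w),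
      Lp.coeFn_const 2 (vol ℓ) c, primL_ae w] with y h1 h2 h3 h4
    rw [h1, h2, Pi.add_apply, h3, h4, Function.const_apply]
  have h1 := hasTrace_const_add_primL c w 0
  rw [← hu, prim, intervalIntegral.integral_same, add_zero] at h1
  rw [h0.unique ⟨le_rfl, hℓ.le⟩ hℓ h1]
  exact hu

/-- Integration by parts in `H¹((0, ℓ); E)`. -/
theorem inner_add_inner_of_hasWeakDeriv (hℓ : 0 < ℓ) {u w u' w' : L2 ℓ E} {e₀ e₁ e₀' e₁' : E}
    (h : HasWeakDeriv ℓ u w) (h' : HasWeakDeriv ℓ u' w') (h0 : HasTrace ℓ u 0 e₀)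
    (h1 : HasTrace ℓ u ℓ e₁) (h0' : HasTrace ℓ u' 0 e₀') (h1' : HasTrace ℓ u' ℓ e₁') :
    inner ℂ u w' + inner ℂ w u' = inner ℂ e₁ e₁' - inner ℂ e₀ e₀' := by
  have hu := h.eq_const_add_primL hℓ h0
  have hu' := h'.eq_const_add_primL hℓ h0'
  have t1 := hasTrace_const_add_primL e₀ w ℓ
  have t1' := hasTrace_const_add_primL e₀' w' ℓ
  rw [← hu] at t1
  rw [← hu'] at t1'
  rw [h1.unique ⟨hℓ.le, le_rfl⟩ hℓ t1, h1'.unique ⟨hℓ.le, le_rfl⟩ hℓ t1', hu, hu', inner_add_left,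
    inner_add_right, inner_const_left hℓ, ← inner_conj_symm w (Lp.const 2 (vol ℓ) e₀'),
    inner_const_left hℓ, inner_conj_symm, inner_add_left, inner_add_right, inner_add_right]
  linear_combination inner_primL_add_inner_primL hℓ w w'

end Parts

/-! ### Restriction to the damped interval and the stress -/

variable {p : Params}

theorem Params.β_pos (p : Params) : 0 < p.β := p.α_pos.trans p.α_lt_β

theorem Params.L_pos (p : Params) : 0 < p.L := p.β_pos.trans p.β_lt_L

theorem HasWeakDeriv.restr {v w : L2 p.L ℂ} (h : HasWeakDeriv p.L v w) :
    HasWeakDeriv p.β (restr p v) (restr p w) := by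
  have hsub : Ioo 0 p.β ⊆ Ioo 0 p.L := Ioo_subset_Ioo_right p.β_lt_L.le
  have key : ∀ (ψ : ℝ → ℝ) (f : L2 p.L ℂ), (∀ x, x ∉ Ioo 0 p.β → ψ x = 0) →
      ∫ x, ψ x • KelvinVoigt.restr p f x ∂(vol p.β) = ∫ x, ψ x • f x ∂(vol p.L) := by
    intro ψ f hψ
    rw [setIntegral_eq_of_subset_of_forall_sdiff_eq_zero measurableSet_Ioo hsub
      fun x hx => by rw [hψ x hx.2, zero_smul]]
    apply integral_congr_ae
    filter_upwards [restr_ae p f] with x hx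
    rw [hx]
  intro φ hφ
  have hd : ∀ x, x ∉ Ioo 0 p.β → deriv φ x = 0 := fun x hx =>
    image_eq_zero_of_notMem_tsupport fun hh => hx (hφ.2.2 (tsupport_deriv_subset hh))
  rw [key _ v hd, key _ w fun x hx => hφ.zero hx]
  exact h φ ⟨hφ.1, hφ.2.1, hφ.2.2.trans hsub⟩

theorem restr_mem_h1Van {v : L2 p.L ℂ} (hv : v ∈ h1Van p.L {0, p.L}) :
    restr p v ∈ h1Van p.β (insert 0 ∅) := by
  refine ⟨hv.1.hasWeakDeriv.restr.isH1, fun x hx => ?_⟩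
  rw [insert_empty_eq, mem_singleton_iff] at hx
  obtain ⟨g, hg, hvg, h0⟩ := hv.2 0 (mem_insert _ _)
  subst hx
  refine ⟨g, hg.mono (Icc_subset_Icc_right p.β_lt_L.le), ?_, h0⟩
  filter_upwards [restr_ae p v, ae_vol_β p hvg] with x h1 h2
  rw [h1, h2]

theorem inner_mulC_symm (v z : L2 p.L ℂ) : inner ℂ v (mulC p z) = inner ℂ (mulC p v) z := by
  rw [L2.inner_def, L2.inner_def]
  apply integral_congr_ae
  filter_upwards [mulC_ae p v, mulC_ae p z] with x h1 h2
  rw [h1, h2]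
  simp only [RCLike.inner_apply, map_mul, Complex.conj_ofReal]
  ring

/-- The stress is affine in `u`, so that `u_x` can be recovered from it once `v` and `η` are
known. -/
theorem Sb_eq_add (u : H10 p.L) (v : L2 p.L ℂ) (η : W p) :
    Sb p u v η = (p.a : ℂ) • H1Van.dx u + Sb p 0 v η := by
  apply Lp.ext
  filter_upwards [Sb_ae p u v η, Sb_ae p 0 v η, Lp.coeFn_smul (p.a : ℂ) (H1Van.dx u),
    Lp.coeFn_add ((p.a : ℂ) • H1Van.dx u) (Sb p 0 v η), Lp.coeFn_zero ℂ 2 (vol p.L)]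
    with x h1 h2 h3 h4 h5
  rw [h1, h4, Pi.add_apply, h2, h3, Pi.smul_apply, stressFun, stressFun, map_zero, h5,
    Pi.zero_apply, mul_zero, zero_add, smul_eq_mul]

theorem Sb_zero_right (u : H10 p.L) : Sb p u 0 0 = (p.a : ℂ) • H1Van.dx u := by
  have h := Sb_smul p 0 (0 : H10 p.L) (HasWeakDeriv.zero p.L).isH1
    (HasWeakDeriv.zero (E := H1L p.β) 1).isH1
  simp only [smul_zero, zero_smul] at h
  rw [Sb_eq_add, h, add_zero]

/-- The part of the stress with the coefficient `b` only sees the interval `(0, β)`. -/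
theorem inner_Sb_zero_left (w v : L2 p.L ℂ) (η : W p) :
    inner ℂ w (Sb p 0 v η) = inner ℂ (restr p w)
      ((p.κ₁ : ℂ) • restr p (wderiv p.L v) + (p.κ₂ : ℂ) • H1Van.dx (trace 1 η 1)) := by
  rw [L2.inner_def, L2.inner_def]
  set F : ℝ → ℂ := fun x => inner ℂ (w x) ((p.κ₁ : ℂ) * wderiv p.L v x
    + (p.κ₂ : ℂ) * H1Van.dx (trace 1 η 1) x) with hF
  have e1 : ∫ x, inner ℂ (w x) (Sb p 0 v η x) ∂(vol p.L)
      = ∫ x, (Ioo 0 p.β).indicator F x ∂(vol p.L) := by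
    apply integral_congr_ae
    filter_upwards [Sb_ae p 0 v η, Lp.coeFn_zero ℂ 2 (vol p.L)] with x h1 h2
    rw [h1, stressFun, map_zero, h2, Pi.zero_apply, mul_zero, zero_add, Params.b]
    by_cases hx : x ∈ Ioo 0 p.β
    · rw [indicator_of_mem hx, indicator_of_mem hx, Complex.ofReal_one, one_mul]
    · rw [indicator_of_notMem hx, indicator_of_notMem hx, Complex.ofReal_zero, zero_mul,
        inner_zero_right]
  rw [e1, integral_indicator measurableSet_Ioo, Measure.restrict_restrict measurableSet_Ioo,
    inter_eq_left.2 (Ioo_subset_Ioo_right p.β_lt_L.le)]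
  apply integral_congr_ae
  filter_upwards [restr_ae p w, restr_ae p (wderiv p.L v),
    Lp.coeFn_add ((p.κ₁ : ℂ) • restr p (wderiv p.L v)) ((p.κ₂ : ℂ) • H1Van.dx (trace 1 η 1)),
    Lp.coeFn_smul (p.κ₁ : ℂ) (restr p (wderiv p.L v)),
    Lp.coeFn_smul (p.κ₂ : ℂ) (H1Van.dx (trace 1 η 1))] with x h1 h2 h3 h4 h5
  rw [h1, h3, Pi.add_apply, h4, h5, Pi.smul_apply, Pi.smul_apply, h2, smul_eq_mul, smul_eq_mul]

/-- Integration by parts against a function of `H¹₀`: there are no boundary terms. -/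
theorem inner_wderiv_of_mem_h1Van {v S : L2 p.L ℂ} (hv : v ∈ h1Van p.L {0, p.L})
    (hS : IsH1 p.L S) : inner ℂ v (wderiv p.L S) = - inner ℂ (wderiv p.L v) S := by
  have h := inner_add_inner_of_hasWeakDeriv p.L_pos hv.1.hasWeakDeriv hS.hasWeakDeriv
    (hv.2 0 (by simp)) (hv.2 p.L (by simp)) (hS.hasTrace p.L_pos 0) (hS.hasTrace p.L_pos p.L)
  rw [inner_zero_left, inner_zero_left, sub_zero] at h
  exact eq_neg_of_add_eq_zero_left h

/-! ### Dissipativity -/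

/-- The dissipation law on the domain, before the use of (H). With `r = v_x` on `(0, β)`, the
viscous damping contributes `-κ₁ ‖r‖²`, the delayed stress `-κ₂ Re (r, η_x(·, 1))`, and the
transport of the history `|κ₂| (‖r‖² - ‖η_x(·, 1)‖²) / 2`. All other terms cancel. -/
theorem re_inner_opA (U : (opA p).domain) : (inner ℂ (U : Energy p) (opA p U)).re
    = -p.κ₁ * ‖restr p (wderiv p.L (U : Energy p).v)‖ ^ 2
      - p.κ₂ * (inner ℂ (restr p (wderiv p.L (U : Energy p).v))
          (H1Van.dx (trace 1 (U : Energy p).η 1))).re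
      + |p.κ₂| / 2 * (‖restr p (wderiv p.L (U : Energy p).v)‖ ^ 2
          - ‖trace 1 (U : Energy p).η 1‖ ^ 2) := by
  obtain ⟨U, h1, h2, h3, h4, h5, h6⟩ := U
  set r := restr p (wderiv p.L U.v) with hr
  set e₀ := trace 1 U.η 0
  set e₁ := trace 1 U.η 1
  have hA : inner ℂ U (opA p ⟨U, h1, h2, h3, h4, h5, h6⟩)
      = (p.a : ℂ) * inner ℂ (H1Van.dx U.u) (wderiv p.L U.v)
        + inner ℂ U.v (wderiv p.L (Sb p U.u U.v U.η) - mulC p U.z)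
        + inner ℂ (H1Van.dx U.y) (wderiv p.L U.z)
        + inner ℂ U.z (wderiv p.L (H1Van.dx U.y) + mulC p U.v)
        + ((p.τ * |p.κ₂| : ℝ) : ℂ) * inner ℂ U.η (-((p.τ⁻¹ : ℝ) : ℂ) • wderiv 1 U.η) := rfl
  have he₀ : ‖e₀‖ = ‖r‖ := by
    have h : H1Van.dx e₀ = r := by
      change wderiv p.β (H1Van.val e₀) = r
      rw [h6]
      exact h2.1.hasWeakDeriv.restr.wderiv_eq
    rw [← H1Van.norm_dx, h]
  have hS := inner_Sb_zero_left (wderiv p.L U.v) U.v U.η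
  have hη := congrArg Complex.re (inner_add_inner_of_hasWeakDeriv one_pos h5.hasWeakDeriv
    h5.hasWeakDeriv (h5.hasTrace one_pos 0) (h5.hasTrace one_pos 1) (h5.hasTrace one_pos 0)
    (h5.hasTrace one_pos 1))
  rw [Complex.add_re, Complex.sub_re, inner_self_re_eq, inner_self_re_eq, he₀,
    ← inner_conj_symm (wderiv 1 U.η), Complex.conj_re] at hη
  have hτ : p.τ * |p.κ₂| * (-p.τ⁻¹) = -|p.κ₂| := by
    have := p.τ_pos.ne'
    field_simp
  have hu : (inner ℂ (wderiv p.L U.v) (H1Van.dx U.u)).re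
      = (inner ℂ (H1Van.dx U.u) (wderiv p.L U.v)).re := by
    rw [← inner_conj_symm, Complex.conj_re]
  have hy : (inner ℂ (wderiv p.L U.z) (H1Van.dx U.y)).re
      = (inner ℂ (H1Van.dx U.y) (wderiv p.L U.z)).re := by
    rw [← inner_conj_symm, Complex.conj_re]
  have hc : (inner ℂ (mulC p U.v) U.z).re = (inner ℂ U.z (mulC p U.v)).re := by
    rw [← inner_conj_symm, Complex.conj_re]
  change (inner ℂ U (opA p ⟨U, h1, h2, h3, h4, h5, h6⟩)).re = _
  rw [hA, inner_sub_right, inner_add_right, inner_wderiv_of_mem_h1Van h2 h4,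
    inner_wderiv_of_mem_h1Van h3 h1, Sb_eq_add, inner_add_right, hS, inner_mulC_symm,
    inner_add_right, inner_smul_right, inner_smul_right, inner_smul_right, inner_smul_right,
    ← Complex.ofReal_neg, ← mul_assoc, ← Complex.ofReal_mul, hτ]
  simp only [Complex.add_re, Complex.sub_re, Complex.neg_re, Complex.re_ofReal_mul, ← hr,
    inner_self_re_eq, hu, hy, hc]
  linear_combination (-|p.κ₂| / 2) * hη

theorem isDissipative_opA (hH : p.HypH) : IsDissipative (opA p) := by
  intro U
  rw [re_inner_opA]
  set n := ‖restr p (wderiv p.L (U : Energy p).v)‖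
  have h1 := (Complex.abs_re_le_norm _).trans (norm_inner_le_norm (𝕜 := ℂ)
    (restr p (wderiv p.L (U : Energy p).v)) (H1Van.dx (trace 1 (U : Energy p).η 1)))
  rw [H1Van.norm_dx] at h1
  set m := ‖trace 1 (U : Energy p).η 1‖
  set q := (inner ℂ (restr p (wderiv p.L (U : Energy p).v))
    (H1Van.dx (trace 1 (U : Energy p).η 1))).re
  have h2 : -(p.κ₂ * q) ≤ |p.κ₂| * (n * m) := by
    refine (neg_le_abs _).trans ?_
    rw [abs_mul]
    exact mul_le_mul_of_nonneg_left h1 (abs_nonneg _)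
  have h3 : 0 ≤ (p.κ₁ - |p.κ₂|) * n ^ 2 := mul_nonneg (sub_nonneg.2 hH.2.2.le) (sq_nonneg _)
  -- The bound is `-(κ₁ - |κ₂|) n² - |κ₂| (n - m)² / 2`.
  have h4 : 0 ≤ |p.κ₂| * (n - m) ^ 2 := mul_nonneg (abs_nonneg _) (sq_nonneg _)
  linarith

/-! ### Bijectivity -/

/-- A function of `H¹₀` with `u_xx = 0` vanishes: `‖u_x‖² = -(u, u_xx) = 0`. -/
theorem eq_zero_of_dx_weakDeriv_zero {u : H10 p.L} (h : HasWeakDeriv p.L (H1Van.dx u) 0) :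
    u = 0 := by
  have h1 := inner_wderiv_of_mem_h1Van u.val_mem h.isH1
  rw [h.wderiv_eq, inner_zero_right, eq_comm, neg_eq_zero] at h1
  exact H1Van.dx_injective ((inner_self_eq_zero.1 h1).trans (map_zero _).symm)

theorem opA_injective (U : (opA p).domain) (hU : opA p U = 0) : U = 0 := by
  obtain ⟨U, h1, h2, h3, h4, h5, h6⟩ := U
  have hv : U.v = 0 := congrArg (fun V : Energy p => H1Van.val V.u) hU
  have hz : U.z = 0 := congrArg (fun V : Energy p => H1Van.val V.y) hU
  have hS : wderiv p.L (Sb p U.u U.v U.η) - mulC p U.z = 0 := congrArg Energy.v hU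
  have hy : wderiv p.L (H1Van.dx U.y) + mulC p U.v = 0 := congrArg Energy.z hU
  have hη : -((p.τ⁻¹ : ℝ) : ℂ) • wderiv 1 U.η = 0 := congrArg Energy.η hU
  have hc0 : mulC p 0 = 0 := by
    have h := mulC_smul p 0 0
    rwa [zero_smul, zero_smul] at h
  have hr0 : restr p 0 = 0 := by
    have h := restr_smul p 0 0
    rwa [zero_smul, zero_smul] at h
  rw [hz, hc0, sub_zero] at hS
  rw [hv, hc0, add_zero] at hy
  have hη0 : U.η = 0 := by
    have hd : wderiv 1 U.η = 0 := (smul_eq_zero.1 hη).resolve_left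
      (neg_ne_zero.2 (Complex.ofReal_ne_zero.2 (inv_ne_zero p.τ_pos.ne')))
    have ht := h5.hasTrace one_pos 0
    have ht0 : trace 1 U.η 0 = 0 := by
      apply H1Van.val_injective
      rw [h6, hv, hr0, map_zero]
    have hw := h5.hasWeakDeriv
    rw [ht0] at ht
    rw [hd] at hw
    exact (hw.ae_eq_prim_of_trace one_pos ht).trans
      ((HasWeakDeriv.zero 1).ae_eq_prim_of_trace one_pos (HasTrace.zero 1 0)).symm
  have hu0 : U.u = 0 := by
    have hw := h4.hasWeakDeriv
    rw [hS, hv, hη0, Sb_zero_right] at hw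
    have hw' := hw.smul (p.a : ℂ)⁻¹
    rw [inv_smul_smul₀ (Complex.ofReal_ne_zero.2 p.a_pos.ne'), smul_zero] at hw'
    exact eq_zero_of_dx_weakDeriv_zero hw'
  have hy0 : U.y = 0 := by
    have hw := h1.hasWeakDeriv
    rw [hy] at hw
    exact eq_zero_of_dx_weakDeriv_zero hw
  exact Subtype.ext (Energy.ext' hu0 hv hy0 hz hη0)

/-- Every function of `L²` is, up to a constant, the derivative of a function of `H¹₀`. -/
theorem exists_dx_eq_add_const (w : L2 p.L ℂ) :
    ∃ (u : H10 p.L) (c : ℂ), H1Van.dx u = Lp.const 2 (vol p.L) c + w := by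
  have hL : (p.L : ℂ) ≠ 0 := Complex.ofReal_ne_zero.2 p.L_pos.ne'
  set c : ℂ := -((p.L : ℂ)⁻¹ • prim p.L w p.L)
  have h : Lp.const 2 (vol p.L) c + w ∈ range (H1Van.dx : H10 p.L → L2 p.L ℂ) := by
    rw [H1Van.mem_range_dx p.L_pos]
    rintro x ⟨rfl, -⟩
    have hc := prim_const p.L_pos c
    have hadd : prim p.L (Lp.const 2 (vol p.L) c + w) p.L
        = prim p.L (Lp.const 2 (vol p.L) c) p.L + prim p.L w p.L := by
      rw [prim_right p.L_pos, prim_right p.L_pos, prim_right p.L_pos,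
        ← integral_add (integrable_L2 _) (integrable_L2 _)]
      exact integral_congr_ae (Lp.coeFn_add _ _)
    rw [hadd, hc, smul_neg, smul_inv_smul₀ hL, neg_add_cancel]
  obtain ⟨u, hu⟩ := h
  exact ⟨u, c, hu⟩

/-- The equation `A U = F` is solved by successive integrations: `v` and `z` are given, `η` is the
primitive of `-τ f₅` that starts at `v`, and the stress and `y_x` are primitives of known functions,
up to constants which the boundary conditions at `L` determine. -/
theorem opA_surjective (F : Energy p) : ∃ U : (opA p).domain, opA p U = F := by
  have ha : (p.a : ℂ) ≠ 0 := Complex.ofReal_ne_zero.2 p.a_pos.ne'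
  set v := H1Van.val F.u with hv
  set z := H1Van.val F.y with hz
  have hvm : v ∈ h1Van p.L {0, p.L} := F.u.val_mem
  have hzm : z ∈ h1Van p.L {0, p.L} := F.y.val_mem
  set e₀ : H1L p.β := H1Van.mk (restr p v) (restr_mem_h1Van hvm) with he₀
  set η : W p := Lp.const 2 (vol 1) e₀ + primL 1 (-(p.τ : ℂ) • F.η) with hη
  have hηw : HasWeakDeriv 1 η (-(p.τ : ℂ) • F.η) := hasWeakDeriv_const_add_primL _ _
  have hη0 : trace 1 η 0 = e₀ := by
    have h := hasTrace_const_add_primL e₀ (-(p.τ : ℂ) • F.η) 0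
    rw [prim, intervalIntegral.integral_same, add_zero] at h
    exact h.trace_eq (by simp) one_pos
  obtain ⟨u, c, hu⟩ := exists_dx_eq_add_const
    ((p.a : ℂ)⁻¹ • (primL p.L (F.v + mulC p z) - Sb p 0 v η))
  obtain ⟨y, c', hy⟩ := exists_dx_eq_add_const (primL p.L (F.z - mulC p v))
  have hS : HasWeakDeriv p.L (Sb p u v η) (F.v + mulC p z) := by
    have h := ((hasWeakDeriv_const (ℓ := p.L) c).smul (p.a : ℂ)).add
      (hasWeakDeriv_primL p.L (F.v + mulC p z))
    rw [smul_zero, zero_add] at h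
    rwa [Sb_eq_add, hu, smul_add, smul_inv_smul₀ ha, add_assoc, sub_add_cancel]
  have hyw : HasWeakDeriv p.L (H1Van.dx y) (F.z - mulC p v) := by
    rw [hy]
    exact hasWeakDeriv_const_add_primL _ _
  refine ⟨⟨Energy.mk u v y z η, hyw.isH1, hvm, hzm, hS.isH1, hηw.isH1, ?_⟩, ?_⟩
  · change H1Van.val (trace 1 η 0) = restr p v
    rw [hη0, he₀, H1Van.val_mk]
  · refine Energy.ext' rfl ?_ rfl ?_ ?_
    · change wderiv p.L (Sb p u v η) - mulC p z = F.v
      rw [hS.wderiv_eq, add_sub_cancel_right]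
    · change wderiv p.L (H1Van.dx y) + mulC p v = F.z
      rw [hyw.wderiv_eq, sub_add_cancel]
    · change -((p.τ⁻¹ : ℝ) : ℂ) • wderiv 1 η = F.η
      rw [hηw.wderiv_eq, smul_smul, neg_mul_neg, ← Complex.ofReal_mul,
        inv_mul_cancel₀ p.τ_pos.ne', Complex.ofReal_one, one_smul]

end KelvinVoigt

end

theorem mainTheorem4 (p : KelvinVoigt.Params) (hH : p.HypH) :
    KelvinVoigt.IsMDissipative (KelvinVoigt.opA p) ∧
    Dense ((KelvinVoigt.opA p).domain : Set (KelvinVoigt.Energy p)) ∧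
    (0 : ℂ) ∈ KelvinVoigt.resolventSetOf (KelvinVoigt.opA p) ∧
    ∃ T : ℝ → KelvinVoigt.Energy p →L[ℂ] KelvinVoigt.Energy p,
      KelvinVoigt.IsContractionSemigroup T ∧
      KelvinVoigt.IsGeneratorOf (KelvinVoigt.opA p) T ∧
      (∀ U₀ : KelvinVoigt.Energy p,
        KelvinVoigt.IsWeakSolution (KelvinVoigt.opA p) U₀ (fun t => T t U₀) ∧
        ∀ U : ℝ → KelvinVoigt.Energy p, KelvinVoigt.IsWeakSolution (KelvinVoigt.opA p) U₀ U →
          Set.EqOn U (fun t => T t U₀) (Set.Ici 0)) ∧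
      (∀ U₀ ∈ (KelvinVoigt.opA p).domain,
        KelvinVoigt.IsStrongSolution (KelvinVoigt.opA p) U₀ (fun t => T t U₀) ∧
        ∀ U : ℝ → KelvinVoigt.Energy p, KelvinVoigt.IsStrongSolution (KelvinVoigt.opA p) U₀ U →
          Set.EqOn U (fun t => T t U₀) (Set.Ici 0)) := by
  exact KelvinVoigt.wellPosed_of_dissipative_of_bijective (KelvinVoigt.opA p)
    (KelvinVoigt.isDissipative_opA hH) KelvinVoigt.opA_injective KelvinVoigt.opA_surjective
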